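/- A box in $\mathbb{R}^d$ is a product $[a_1,b_1]\times\dots\times[a_d,b_d]$ of closed intervals (so boxes are axis-parallel). The Delaunay graph of a finite set $P\subset\mathbb{R}^d$ with respect to boxes is the graph with vertex set $P$ in which two distinct points $x,y\in P$ are joined by an edge if and only if there is a box $B$ with $B\cap P=\{x,y\}$. The independence number of a graph is the largest size of a set of pairwise non-adjacent vertices. Theorem. For every integer $d\geq 3$ there exists $c>0$ such that the following holds for every sufficiently large integer $n$. There exists a set of $n$ points in $\mathbb{R}^d$ whose Delaunay graph with respect to boxes has independence number at most $$\frac{c\,n\,(\log\log n)^{(d+3)/2}}{(\log n)^{(d-1)/2}}.$$ -/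

import Mathlib

/-- The family of axis-parallel boxes in `ℝ^d`: products `[a₁, b₁] × ⋯ × [a_d, b_d]` of closed
bounded intervals with `aᵢ ≤ bᵢ`. -/
def axisParallelBoxes (d : ℕ) : Set (Set (Fin d → ℝ)) :=
  {B | ∃ a b : Fin d → ℝ, (∀ i, a i ≤ b i) ∧ B = Set.univ.pi fun i => Set.Icc (a i) (b i)}

/-- The Delaunay graph of a point set `P` with respect to a family `𝒞` of sets: the vertex set
is `P`, and two distinct points `x`, `y` of `P` are adjacent if some `C ∈ 𝒞` satisfies
`C ∩ P = {x, y}`. -/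
def delaunayGraph {X : Type*} (𝒞 : Set (Set X)) (P : Set X) : SimpleGraph P where
  Adj x y := x ≠ y ∧ ∃ C ∈ 𝒞, C ∩ P = {(x : X), (y : X)}
  symm := ⟨fun x y h => by
    obtain ⟨hne, C, hC, h⟩ := h
    exact ⟨hne.symm, C, hC, by rw [h, Set.pair_comm]⟩⟩
  loopless := ⟨fun _ h => h.1 rfl⟩

/-! ### Sums of products over choices made one at a time. -/

section Counting
open scoped Classical
open Finset

/-! The construction is random. Each point carries its index, `b` random words of `k` digits over a
large alphabet, and one random word of `k` colours out of `2 * L`. The lexicographic order turns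
every word into a real coordinate, so a box spanned by two points with common prefixes contains only
points with those prefixes. Hence two points are adjacent as soon as no point of intermediate index
shares their prefixes (`exists_points_of_words`).

Fix a set `I` of `m` points and a time `t`, the number of colour digits already revealed. Each of
the `k ^ b` scales `s` (a prefix length for every word) splits the points into cells. Most points of
`I` have a predecessor of `I` in their cell with at most `L` points in between
(`mul_card_le_isPred`), and most of these pairs differ in the next digit of every word
(`card_many_agree_le`). The latter makes pairs from different scales distinct, so there are at least
`k ^ b * m / 2` candidate pairs. A pair becomes an edge of the Delaunay graph if its next colours
agree in a colour missing between its endpoints; at least half of all colours qualify.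

These events are dependent, but a weighted sequential count (`card_coloring_le`) still bounds the
probability that all `e` pairs fail by `exp (-e / (16 * L))`. Over the `k` times this gives `exp (-k
^ (b + 1) * m / (32 * L))` (`card_forall_avoids_le`), which beats the at most `L ^ m` choices of `I`
once `k ^ (b + 1) ≥ 64 * L * log L`. Having few cells compared with `m` restricts `k` to order `log
n / log log n`; with `b = d / 2 - 1` this permits the required `L`, and `m` is about `8 * n / L`. -/

theorem sum_prod_le_prod_fin {X : Type*} [Fintype X] [Nonempty X] (m : ℕ)
    (f : Fin m → (Fin m → X) → ℝ) (ρ : Fin m → ℝ) (h0 : ∀ i z, 0 ≤ f i z)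
    (hdep : ∀ i z z', (∀ j ≤ i, z j = z' j) → f i z = f i z')
    (hρ : ∀ i z, ∑ x, f i (Function.update z i x) ≤ ρ i) :
    ∑ z, ∏ i, f i z ≤ ∏ i, ρ i := by
  induction m with
  | zero => simp
  | succ m ih =>
    have hρ0 : ∀ i, 0 ≤ ρ i := fun i =>
      (Finset.sum_nonneg fun x _ => h0 i _).trans (hρ i fun _ => Classical.arbitrary X)
    have key : ∀ x : X, ∑ z : Fin m → X, ∏ i, f i (Fin.cons x z : Fin (m + 1) → X) ≤
        f 0 (fun _ => x) * ∏ i : Fin m, ρ i.succ := by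
      intro x
      have h1 : ∀ z : Fin m → X, f 0 (Fin.cons x z : Fin (m + 1) → X) = f 0 (fun _ => x) := by
        intro z
        refine hdep _ _ _ fun j hj => ?_
        obtain rfl : j = 0 := by simpa using hj
        rfl
      simp_rw [Fin.prod_univ_succ, h1, ← Finset.mul_sum]
      refine mul_le_mul_of_nonneg_left ?_ (h0 _ _)
      refine ih (fun i z => f i.succ (Fin.cons x z : Fin (m + 1) → X)) _ (fun _ _ => h0 _ _) ?_ ?_
      · intro i z z' h
        refine hdep _ _ _ fun j hj => ?_
        cases j using Fin.cases with
        | zero => rfl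
        | succ j => simpa using h j (by simpa using hj)
      · intro i z
        have := hρ i.succ (Fin.cons x z : Fin (m + 1) → X)
        simpa [← Fin.cons_update] using this
    rw [← (Fin.consEquiv fun _ : Fin (m + 1) => X).sum_comp, Fintype.sum_prod_type]
    calc _ ≤ ∑ x, f 0 (fun _ => x) * ∏ i : Fin m, ρ i.succ := Finset.sum_le_sum fun x _ => key x
      _ = (∑ x, f 0 (fun _ => x)) * ∏ i : Fin m, ρ i.succ := by rw [Finset.sum_mul]
      _ ≤ ρ 0 * ∏ i : Fin m, ρ i.succ := by
        refine mul_le_mul_of_nonneg_right ?_ (Finset.prod_nonneg fun i _ => hρ0 _)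
        refine le_trans (le_of_eq ?_) (hρ 0 fun _ => Classical.arbitrary X)
        refine Finset.sum_congr rfl fun x _ => hdep _ _ _ fun j hj => ?_
        obtain rfl : j = 0 := by simpa using hj
        simp
      _ = _ := (Fin.prod_univ_succ _).symm

/-- If the weight `f i` depends only on the coordinates up to `i`, and its sum over the `i`-th
coordinate never exceeds `ρ i`, then the total of the product weights is at most `∏ i, ρ i`. -/
theorem sum_prod_le_prod {ι X : Type*} [Fintype ι] [LinearOrder ι] [Fintype X] [Nonempty X]
    (f : ι → (ι → X) → ℝ) (ρ : ι → ℝ) (h0 : ∀ i z, 0 ≤ f i z)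
    (hdep : ∀ i z z', (∀ j ≤ i, z j = z' j) → f i z = f i z')
    (hρ : ∀ i z, ∑ x, f i (Function.update z i x) ≤ ρ i) :
    ∑ z, ∏ i, f i z ≤ ∏ i, ρ i := by
  let e : Fin (Fintype.card ι) ≃o ι := Fintype.orderIsoFinOfCardEq ι rfl
  have := sum_prod_le_prod_fin (X := X) _ (fun i z => f (e i) (z ∘ e.symm)) (fun i => ρ (e i))
    (fun _ _ => h0 _ _) (fun i z z' h => hdep _ _ _ fun j hj => h _ (by
      rwa [← e.le_iff_le, e.apply_symm_apply])) (fun i z => by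
      refine le_trans (le_of_eq ?_) (hρ (e i) (z ∘ e.symm))
      refine Finset.sum_congr rfl fun x _ => ?_
      congr 1
      ext j
      by_cases hj : j = e i
      · subst hj; simp
      · have : e.symm j ≠ i := fun h => hj (by rw [← h, e.apply_symm_apply])
        simp [hj, this])
  have hcomp : ∏ i, ρ (e i) = ∏ i, ρ i := e.toEquiv.prod_comp ρ
  rw [hcomp] at this
  refine le_trans (le_of_eq ?_) this
  rw [← (e.toEquiv.arrowCongr (Equiv.refl X)).sum_comp]
  refine Finset.sum_congr rfl fun z _ => ?_
  rw [← e.toEquiv.prod_comp]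
  rfl

/-! ### Consecutive elements of a set within colour classes. -/

/-- `q` and `p` are consecutive elements of `I` among those with the same value of `κ`. -/
def IsPred {ι C : Type*} [LinearOrder ι] (κ : ι → C) (I : Finset ι) (q p : ι) : Prop :=
  q ∈ I ∧ p ∈ I ∧ q < p ∧ κ q = κ p ∧ ∀ i ∈ I, q < i → i < p → κ i ≠ κ p

theorem IsPred.left_unique {ι C : Type*} [LinearOrder ι] {κ : ι → C} {I : Finset ι} {q q' p : ι}
    (h : IsPred κ I q p) (h' : IsPred κ I q' p) : q = q' := by
  rcases lt_trichotomy q q' with hq | hq | hq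
  · exact absurd h'.2.2.2.1 (h.2.2.2.2 q' h'.1 hq h'.2.2.1)
  · exact hq
  · exact absurd h.2.2.2.1 (h'.2.2.2.2 q h.1 hq h.2.2.1)

theorem IsPred.right_unique {ι C : Type*} [LinearOrder ι] {κ : ι → C} {I : Finset ι} {q p p' : ι}
    (h : IsPred κ I q p) (h' : IsPred κ I q p') : p = p' := by
  have hκ : κ p = κ p' := h.2.2.2.1.symm.trans h'.2.2.2.1
  rcases lt_trichotomy p p' with hq | hq | hq
  · exact absurd hκ (h'.2.2.2.2 p h.2.1 h.2.2.1 hq)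
  · exact hq
  · exact absurd hκ.symm (h.2.2.2.2 p' h'.2.1 h'.2.2.1 hq)

theorem exists_isPred {ι C : Type*} [LinearOrder ι] {κ : ι → C} {I : Finset ι} {q p : ι}
    (hq : q ∈ I) (hp : p ∈ I) (hqp : q < p) (hκ : κ q = κ p) : ∃ q', IsPred κ I q' p := by
  have hne : (I.filter fun i => i < p ∧ κ i = κ p).Nonempty := ⟨q, by simp [*]⟩
  obtain ⟨h1, h2, h3⟩ := Finset.mem_filter.1 (Finset.max'_mem _ hne)
  refine ⟨_, h1, hp, h2, h3, fun i hi hlt hip hk => ?_⟩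
  exact absurd (Finset.le_max' _ i (by simp [hi, hip, hk])) (not_le.2 hlt)

/-- The elements with the same value of `κ` strictly between `q` and `p`. -/
noncomputable def between {ι C : Type*} [LinearOrder ι] [Fintype ι] (κ : ι → C) (q p : ι) :
    Finset ι :=
  univ.filter fun i => q < i ∧ i < p ∧ κ i = κ p

/-- An element of `I` without predecessor is the first of its class, so there are at most as many as
classes. Gaps with more than `L` elements are pairwise disjoint, so `L` times their number is at
most the size of `ι`. -/
theorem mul_card_le_isPred {ι C : Type*} [LinearOrder ι] [Fintype ι] [Fintype C] (κ : ι → C)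
    (I : Finset ι) (L : ℕ) :
    L * I.card ≤ L * (I.filter fun p => ∃ q, IsPred κ I q p ∧ (between κ q p).card ≤ L).card +
      L * Fintype.card C + Fintype.card ι := by
  set A := I.filter fun p => ∃ q, IsPred κ I q p ∧ (between κ q p).card ≤ L
  set B := I.filter fun p => ¬ ∃ q, IsPred κ I q p
  set E := I.filter fun p => ∃ q, IsPred κ I q p ∧ L < (between κ q p).card
  have hI : I ⊆ A ∪ B ∪ E := by
    intro p hp
    by_cases h : ∃ q, IsPred κ I q p
    · obtain ⟨q, hq⟩ := h
      rcases le_or_gt (between κ q p).card L with h | h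
      · have : p ∈ A := mem_filter.2 ⟨hp, q, hq, h⟩
        simp [this]
      · have : p ∈ E := mem_filter.2 ⟨hp, q, hq, h⟩
        simp [this]
    · have : p ∈ B := mem_filter.2 ⟨hp, h⟩
      simp [this]
  have hcard : I.card ≤ A.card + B.card + E.card :=
    (card_le_card hI).trans ((card_union_le _ _).trans (Nat.add_le_add_right (card_union_le _ _) _))
  have hB : B.card ≤ Fintype.card C := by
    refine Finset.card_le_card_of_injOn κ (fun _ _ => mem_univ _) ?_
    intro p hp p' hp' hk
    simp only [B, coe_filter, Set.mem_ofPred_eq] at hp hp'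
    rcases lt_trichotomy p p' with h | h | h
    · exact absurd (exists_isPred hp.1 hp'.1 h hk) hp'.2
    · exact h
    · exact absurd (exists_isPred hp'.1 hp.1 h hk.symm) hp.2
  have hE : L * E.card ≤ Fintype.card ι := by
    have hch : ∀ p ∈ E, ∃ q, IsPred κ I q p ∧ L < (between κ q p).card := fun p hp =>
      (mem_filter.1 hp).2
    choose! g hg using hch
    have hdisj : (E : Set ι).PairwiseDisjoint fun p => between κ (g p) p := by
      intro p hp p' hp' hne
      rw [Function.onFun, Finset.disjoint_left]
      intro i hi hi'
      simp only [between, mem_filter, mem_univ, true_and] at hi hi'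
      have hk : κ p = κ p' := hi.2.2.symm.trans hi'.2.2
      rcases lt_trichotomy p p' with h | h | h
      · exact (hg p' hp').1.2.2.2.2 p (hg p hp).1.2.1 (hi'.1.trans hi.2.1) h hk
      · exact hne h
      · exact (hg p hp).1.2.2.2.2 p' (hg p' hp').1.2.1 (hi.1.trans hi'.2.1) h hk.symm
    calc L * E.card = ∑ p ∈ E, L := by simp [mul_comm]
      _ ≤ ∑ p ∈ E, (between κ (g p) p).card := Finset.sum_le_sum fun p hp => (hg p hp).2.le
      _ = (E.biUnion fun p => between κ (g p) p).card := (Finset.card_biUnion hdisj).symm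
      _ ≤ _ := Finset.card_le_univ _
  nlinarith [Nat.mul_le_mul_left L hcard, Nat.mul_le_mul_left L hB]

/-! ### Colourings without monochromatic edges in allowed colours. -/

theorem Real.exp_neg_le_one_sub_half {x : ℝ} (h0 : 0 ≤ x) (h1 : x ≤ 1) :
    Real.exp (-x) ≤ 1 - x / 2 := by
  have hpos : 0 < 1 + x := by linarith
  have h2 : Real.exp (-x) ≤ (1 + x)⁻¹ := by
    rw [Real.exp_neg]
    exact inv_anti₀ hpos (by linarith [Real.add_one_le_exp x])
  refine h2.trans ?_
  rw [inv_le_iff_one_le_mul₀ hpos]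
  nlinarith

/-- One step of the sequential colouring estimate: `S` is the set of colours forbidden at the
current vertex, `O` the set of its later neighbours, and `F p` the set of colours which are newly
forbidden at `p` when they are used at the current vertex. -/
theorem sum_color_step {ι β : Type*} [Fintype β] [Nonempty β] (O : Finset ι) (F : ι → Finset β)
    (S : Finset β) (hS : 8 * S.card ≤ Fintype.card β) (hO : O.card ≤ Fintype.card β)
    (hF : ∀ p ∈ O, 3 * Fintype.card β ≤ 8 * (F p).card) :
    ∑ c, (if c ∈ S then 0 else
        Real.exp ((S.card : ℝ) / Fintype.card β -
          ((O.filter fun p => c ∈ F p).card : ℝ) / Fintype.card β)) ≤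
      Fintype.card β * Real.exp (-(O.card : ℝ) / (8 * Fintype.card β)) := by
  set D : ℝ := (Fintype.card β : ℝ) with hD
  have hDpos : 0 < D := by
    rw [hD]; exact_mod_cast Fintype.card_pos
  have h1 : ∀ c, (if c ∈ S then 0 else Real.exp ((S.card : ℝ) / D -
      ((O.filter fun p => c ∈ F p).card : ℝ) / D)) ≤
      Real.exp (S.card / D) * ((if c ∈ S then 0 else 1) -
        (∑ p ∈ O, if c ∈ F p ∧ c ∉ S then 1 else 0) / (2 * D)) := by
    intro c
    by_cases hc : c ∈ S
    · simp [hc]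
    · simp only [hc, if_false, not_false_iff, and_true]
      rw [sub_eq_add_neg, Real.exp_add]
      refine mul_le_mul_of_nonneg_left ?_ (Real.exp_pos _).le
      rw [← Finset.sum_filter]
      have hle : ((O.filter fun p => c ∈ F p).card : ℝ) ≤ D := by
        rw [hD]
        exact_mod_cast (Finset.card_filter_le _ _).trans hO
      refine (Real.exp_neg_le_one_sub_half (by positivity) ((div_le_one hDpos).2 hle)).trans ?_
      rw [Finset.sum_const, nsmul_eq_mul, mul_one]
      apply le_of_eq
      field_simp
  refine (Finset.sum_le_sum fun c _ => h1 c).trans ?_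
  rw [← Finset.mul_sum, Finset.sum_sub_distrib, ← Finset.sum_div, Finset.sum_comm]
  have h2 : ∑ c : β, (if c ∈ S then (0 : ℝ) else 1) = D - S.card := by
    have : ∀ c, (if c ∈ S then (0 : ℝ) else 1) = 1 - if c ∈ S then 1 else 0 := by
      intro c; split_ifs <;> norm_num
    simp [this, Finset.sum_sub_distrib, hD]
  -- Of at least `3 * D / 8` newly forbidden colours at most `D / 8` lie in `S`; the remaining `D /
  -- 4`, halved by the bound on `exp`, give the `1 / 8` in the conclusion.
  have h3 : ∀ p ∈ O, D / 4 ≤ ∑ c : β, (if c ∈ F p ∧ c ∉ S then (1 : ℝ) else 0) := by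
    intro p hp
    rw [← Finset.sum_filter, Finset.sum_const, nsmul_eq_mul, mul_one]
    have : (univ.filter fun c => c ∈ F p ∧ c ∉ S) = F p \ S := by ext; simp
    rw [this]
    have h4 := Finset.le_card_sdiff S (F p)
    have h5 := hF p hp
    have h6 : Fintype.card β ≤ 4 * (F p \ S).card := by omega
    have h7 : D ≤ 4 * ((F p \ S).card : ℝ) := by rw [hD]; exact_mod_cast h6
    linarith
  have h4 : (O.card : ℝ) * (D / 4) ≤ ∑ p ∈ O, ∑ c : β, (if c ∈ F p ∧ c ∉ S then (1 : ℝ) else 0) := by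
    rw [← nsmul_eq_mul, ← Finset.sum_const]
    exact Finset.sum_le_sum h3
  rw [h2]
  have h5 : D - S.card - (∑ p ∈ O, ∑ c : β, (if c ∈ F p ∧ c ∉ S then (1 : ℝ) else 0)) / (2 * D) ≤
      D * Real.exp (-(S.card / D) + -(O.card : ℝ) / (8 * D)) := by
    have h6 : (O.card : ℝ) / 8 ≤
        (∑ p ∈ O, ∑ c : β, (if c ∈ F p ∧ c ∉ S then (1 : ℝ) else 0)) / (2 * D) := by
      rw [le_div_iff₀ (by positivity)]
      linarith
    have h7 := Real.add_one_le_exp (-(S.card / D) + -(O.card : ℝ) / (8 * D))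
    have h8 : D * (-(S.card / D) + -(O.card : ℝ) / (8 * D) + 1) = D - S.card - O.card / 8 := by
      field_simp
      ring
    have h9 := mul_le_mul_of_nonneg_left h7 hDpos.le
    linarith
  calc _ ≤ Real.exp (S.card / D) * (D * Real.exp (-(S.card / D) + -(O.card : ℝ) / (8 * D))) :=
        mul_le_mul_of_nonneg_left h5 (Real.exp_pos _).le
    _ = D * (Real.exp (S.card / D) * Real.exp (-(S.card / D) + -(O.card : ℝ) / (8 * D))) := by ring
    _ = _ := by rw [← Real.exp_add]; congr 2; ring

section Coloring

variable {ι β : Type*} [Fintype ι] [LinearOrder ι]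

/-- The colours forbidden at `p` by the neighbours of `p` which precede `i`. -/
noncomputable def forbidden (A : ι → ι → Finset β) (w : ι → β) (i p : ι) : Finset β :=
  (univ.filter fun q => q < i ∧ w q ∈ A q p).image w

theorem mem_forbidden {A : ι → ι → Finset β} {w : ι → β} {i p : ι} {c : β} :
    c ∈ forbidden A w i p ↔ ∃ q, (q < i ∧ w q ∈ A q p) ∧ w q = c := by
  simp [forbidden]

theorem forbidden_congr {A : ι → ι → Finset β} {w w' : ι → β} {i : ι}
    (h : ∀ j < i, w j = w' j) (p : ι) : forbidden A w i p = forbidden A w' i p := by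
  ext c
  simp only [mem_forbidden]
  refine exists_congr fun q => ?_
  constructor
  · rintro ⟨⟨hq, hA⟩, hc⟩
    rw [h q hq] at hA hc
    exact ⟨⟨hq, hA⟩, hc⟩
  · rintro ⟨⟨hq, hA⟩, hc⟩
    rw [← h q hq] at hA hc
    exact ⟨⟨hq, hA⟩, hc⟩

/-- The number of forbidden colours at `p` is the number of neighbours of `p` contributing a new
colour. -/
theorem card_forbidden (A : ι → ι → Finset β) (w : ι → β) (p : ι) (hA : ∀ q, ¬ q < p → A q p = ∅) :
    (forbidden A w p p).card =
      (univ.filter fun q => w q ∈ A q p \ forbidden A w q p).card := by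
  symm
  refine Finset.card_bij (fun q _ => w q) ?_ ?_ ?_
  · intro q hq
    simp only [mem_filter, mem_univ, true_and, mem_sdiff] at hq
    refine mem_forbidden.2 ⟨q, ⟨?_, hq.1⟩, rfl⟩
    by_contra h
    simp [hA q h] at hq
  · intro q hq q' hq' h
    simp only [mem_filter, mem_univ, true_and, mem_sdiff] at hq hq'
    rcases lt_trichotomy q q' with hlt | hlt | hlt
    · exact absurd (mem_forbidden.2 ⟨q, ⟨hlt, hq.1⟩, h⟩) hq'.2
    · exact hlt
    · exact absurd (mem_forbidden.2 ⟨q', ⟨hlt, hq'.1⟩, h.symm⟩) hq.2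
  · intro c hc
    obtain ⟨q, hq, rfl⟩ := mem_forbidden.1 hc
    have hne : (univ.filter fun q' => w q' ∈ A q' p ∧ w q' = w q).Nonempty := ⟨q, by simp [hq.2]⟩
    obtain ⟨-, h1, h2⟩ := Finset.mem_filter.1 (Finset.min'_mem _ hne)
    refine ⟨_, ?_, h2⟩
    simp only [mem_filter, mem_univ, true_and, mem_sdiff]
    refine ⟨h1, fun h => ?_⟩
    obtain ⟨q', ⟨hlt, h3⟩, h4⟩ := mem_forbidden.1 h
    exact absurd (Finset.min'_le _ q' (mem_filter.2 ⟨mem_univ _, h3, h4.trans h2⟩)) (not_le.2 hlt)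

/-- Vertices are coloured in order. A vertex with forbidden set `S` survives with probability `1 -
|S| / D`, but the sets `S` depend on the past and may be small when neighbours repeat colours. The
weight compensates: it pays `exp (|S| / D)` back at the vertex and charges `exp (-1 / D)` each time
a colour becomes newly forbidden at a later neighbour. On a valid colouring the payments cancel, and
every step loses a factor governed by the out-degree alone. -/
theorem card_coloring_le [Fintype β] [Nonempty β] (A : ι → ι → Finset β) (E : ι → ι → Prop)
    (hlt : ∀ q p, E q p → q < p) (hA : ∀ q p, E q p → Fintype.card β ≤ 2 * (A q p).card)
    (hA' : ∀ q p, ¬ E q p → A q p = ∅)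
    (hin : ∀ p, 8 * (univ.filter fun q => E q p).card ≤ Fintype.card β)
    (hout : ∀ q, (univ.filter fun p => E q p).card ≤ Fintype.card β) :
    ((univ.filter fun w : ι → β => ∀ q p, w q ∈ A q p → w p ≠ w q).card : ℝ) ≤
      (Fintype.card β : ℝ) ^ Fintype.card ι *
        Real.exp (-((univ.filter fun e : ι × ι => E e.1 e.2).card : ℝ) / (8 * Fintype.card β)) := by
  set D : ℝ := (Fintype.card β : ℝ) with hD
  have hAlt : ∀ {q p : ι} {c : β}, c ∈ A q p → E q p := by
    intro q p c hc
    by_contra h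
    simp [hA' q p h] at hc
  have hSE : ∀ (w : ι → β) (i p : ι), 8 * (forbidden A w i p).card ≤ Fintype.card β := by
    intro w i p
    refine le_trans (Nat.mul_le_mul_left 8 (Finset.card_image_le.trans (card_le_card ?_))) (hin p)
    intro q hq
    simp only [mem_filter, mem_univ, true_and] at hq ⊢
    exact hAlt hq.2
  set O : ι → Finset ι := fun i => univ.filter fun p => E i p with hO
  set F : (ι → β) → ι → ι → Finset β := fun w i p => A i p \ forbidden A w i p with hF
  set f : ι → (ι → β) → ℝ := fun i w => if w i ∈ forbidden A w i i then 0 else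
    Real.exp (((forbidden A w i i).card : ℝ) / D -
      (((O i).filter fun p => w i ∈ F w i p).card : ℝ) / D) with hf
  have main := sum_prod_le_prod f
    (fun i => D * Real.exp (-((O i).card : ℝ) / (8 * D)))
    (fun i w => by simp only [hf]; split_ifs; exacts [le_rfl, (Real.exp_pos _).le])
    (by
      intro i w w' h
      have h1 := h i le_rfl
      have h2 : ∀ p, forbidden A w i p = forbidden A w' i p :=
        forbidden_congr fun j hj => h j hj.le
      simp only [hf, hF, h1, h2])
    (by
      intro i w
      have h2 : ∀ x p, forbidden A (Function.update w i x) i p = forbidden A w i p := fun x =>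
        forbidden_congr fun j hj => by rw [Function.update_of_ne hj.ne]
      simp only [hf, hF, h2, Function.update_self]
      refine sum_color_step (O i) (fun p => A i p \ forbidden A w i p) _ (hSE w i i) (hout i) ?_
      intro p hp
      have h3 := hA i p (by simpa [hO] using hp)
      have h4 := hSE w i p
      have h5 := Finset.le_card_sdiff (forbidden A w i p) (A i p)
      omega)
  have hcount : ((univ.filter fun w : ι → β => ∀ q p, w q ∈ A q p → w p ≠ w q).card : ℝ) ≤
      ∑ w, ∏ i, f i w := by
    rw [Finset.cast_card]
    refine le_trans ?_ (Finset.sum_le_univ_sum_of_nonneg (s := univ.filter fun w : ι → β =>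
      ∀ q p, w q ∈ A q p → w p ≠ w q) fun w => Finset.prod_nonneg fun i _ => ?_)
    · refine Finset.sum_le_sum fun w hw => ?_
      simp only [mem_filter, mem_univ, true_and] at hw
      have hnot : ∀ i, w i ∉ forbidden A w i i := by
        intro i hi
        obtain ⟨q, hq, hqi⟩ := mem_forbidden.1 hi
        exact hw q i hq.2 hqi.symm
      simp only [hf, hnot, if_false]
      rw [← Real.exp_sum, Finset.sum_sub_distrib, ← Finset.sum_div, ← Finset.sum_div]
      -- The cancellation: each forbidden colour at `p` is charged exactly once, to the first
      -- neighbour that uses it.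
      have hsum : ∑ i, ((forbidden A w i i).card : ℝ) =
          ∑ i, (((O i).filter fun p => w i ∈ F w i p).card : ℝ) := by
        have e1 : ∀ p, ((forbidden A w p p).card : ℝ) =
            ∑ q, if w q ∈ F w q p then 1 else 0 := by
          intro p
          rw [card_forbidden A w p fun q hq => hA' q p fun h => hq (hlt _ _ h)]
          simp [hF]
        have e2 : ∀ q, (((O q).filter fun p => w q ∈ F w q p).card : ℝ) =
            ∑ p, if w q ∈ F w q p then 1 else 0 := by
          intro q
          rw [← Finset.sum_filter, Finset.sum_const, nsmul_eq_mul, mul_one]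
          congr 2
          ext p
          simp only [hO, hF, mem_filter, mem_univ, true_and, mem_sdiff]
          exact ⟨fun h => h.2, fun h => ⟨hAlt h.1, h⟩⟩
        simp_rw [e1, e2]
        rw [Finset.sum_comm]
      rw [hsum]
      simp
    · simp only [hf]; split_ifs; exacts [le_rfl, (Real.exp_pos _).le]
  refine hcount.trans (main.trans (le_of_eq ?_))
  rw [Finset.prod_mul_distrib, Finset.prod_const, ← Real.exp_sum, Finset.card_univ]
  congr 2
  rw [← Finset.sum_div, Finset.sum_neg_distrib]
  congr 2
  rw [← Nat.cast_sum]
  congr 1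
  simp only [hO, Finset.card_filter]
  rw [Fintype.sum_prod_type]

end Coloring
/-- The estimate `card_coloring_le` when only the vertices of `I` carry edges and the lists of
allowed colours may depend on the colours outside `I`. -/
theorem card_coloring_le_of_subset {ι β : Type*} [Fintype ι] [LinearOrder ι] [Fintype β]
    [Nonempty β] (I : Finset ι) (A : (ι → β) → ι → ι → Finset β) (E : ι → ι → Prop)
    (hAw : ∀ w w', (∀ i ∉ I, w i = w' i) → A w = A w')
    (hEI : ∀ q p, E q p → q ∈ I ∧ p ∈ I)
    (hlt : ∀ q p, E q p → q < p) (hA : ∀ w q p, E q p → Fintype.card β ≤ 2 * (A w q p).card)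
    (hA' : ∀ w q p, ¬ E q p → A w q p = ∅)
    (hin : ∀ p, 8 * (univ.filter fun q => E q p).card ≤ Fintype.card β)
    (hout : ∀ q, (univ.filter fun p => E q p).card ≤ Fintype.card β) :
    ((univ.filter fun w : ι → β => ∀ q p, w q ∈ A w q p → w p ≠ w q).card : ℝ) ≤
      (Fintype.card β : ℝ) ^ Fintype.card ι *
        Real.exp (-((univ.filter fun e : ι × ι => E e.1 e.2).card : ℝ) / (8 * Fintype.card β)) := by
  set ε := Real.exp (-((univ.filter fun e : ι × ι => E e.1 e.2).card : ℝ) / (8 * Fintype.card β))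
    with hε
  let e := Equiv.piEquivPiSubtypeProd (fun i => i ∈ I) (fun _ : ι => β)
  -- Once the colours `v` outside `I` are fixed, the lists no longer vary and the previous estimate
  -- applies to the colours on `I`.
  have hfix : ∀ v : {i // i ∉ I} → β,
      ((univ.filter fun u : {i // i ∈ I} → β =>
        ∀ q p, e.symm (u, v) q ∈ A (e.symm (u, v)) q p →
          e.symm (u, v) p ≠ e.symm (u, v) q).card : ℝ) ≤
        (Fintype.card β : ℝ) ^ Fintype.card {i // i ∈ I} * ε := by
    intro v
    set w₀ := e.symm (fun _ => Classical.arbitrary β, v) with hw₀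
    have hjoin : ∀ u, A (e.symm (u, v)) = A w₀ := by
      intro u
      refine hAw _ _ fun i hi => ?_
      simp [hw₀, e, Equiv.piEquivPiSubtypeProd, hi]
    have hu : ∀ (u : {i // i ∈ I} → β) (i : {i // i ∈ I}), e.symm (u, v) i = u i := by
      intro u i
      simp [e, Equiv.piEquivPiSubtypeProd]
    have h1 := card_coloring_le (ι := {i // i ∈ I}) (β := β) (fun q p => A w₀ q p)
      (fun q p => E q p) (fun q p h => hlt _ _ h) (fun q p h => hA _ _ _ h)
      (fun q p h => hA' _ _ _ h)
      (fun p => le_trans (Nat.mul_le_mul_left 8 (Finset.card_le_card_of_injOn Subtype.val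
        (fun q hq => by simpa using hq) Subtype.val_injective.injOn)) (hin p))
      (fun q => le_trans (Finset.card_le_card_of_injOn Subtype.val
        (fun p hp => by simpa using hp) Subtype.val_injective.injOn) (hout q))
    have h2 : (univ.filter fun e : ι × ι => E e.1 e.2).card ≤
        (univ.filter fun e : {i // i ∈ I} × {i // i ∈ I} => E e.1 e.2).card := by
      refine le_trans (Finset.card_le_card ?_) (Finset.card_image_le
        (f := fun e : {i // i ∈ I} × {i // i ∈ I} => ((e.1 : ι), (e.2 : ι))))
      rintro ⟨q, p⟩ h
      have h : E q p := by simpa using h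
      exact mem_image.2 ⟨(⟨q, (hEI q p h).1⟩, ⟨p, (hEI q p h).2⟩), by simpa using h, rfl⟩
    refine le_trans ?_ (h1.trans (mul_le_mul_of_nonneg_left ?_ (by positivity)))
    · refine Nat.cast_le.2 (Finset.card_le_card ?_)
      intro u h
      simp only [mem_filter, mem_univ, true_and] at h ⊢
      intro q p hq
      have := h q p (by rw [hjoin, hu]; exact hq)
      rwa [hu, hu] at this
    · refine Real.exp_le_exp.2 ?_
      gcongr
  have hsum : ((univ.filter fun w : ι → β => ∀ q p, w q ∈ A w q p → w p ≠ w q).card : ℝ) =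
      ∑ v : {i // i ∉ I} → β, ((univ.filter fun u : {i // i ∈ I} → β =>
        ∀ q p, e.symm (u, v) q ∈ A (e.symm (u, v)) q p →
          e.symm (u, v) p ≠ e.symm (u, v) q).card : ℝ) := by
    simp only [Finset.card_filter]
    push_cast
    rw [← e.symm.sum_comp, Fintype.sum_prod_type_right]
  rw [hsum]
  refine (Finset.sum_le_sum fun v _ => hfix v).trans (le_of_eq ?_)
  rw [Finset.sum_const, nsmul_eq_mul, Finset.card_univ, Fintype.card_fun]
  have hc : Fintype.card ι = Fintype.card {i // i ∉ I} + Fintype.card {i // i ∈ I} := by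
    rw [add_comm, Fintype.card_subtype_compl]
    have := Fintype.card_subtype_le (fun i => i ∈ I)
    omega
  rw [hc, pow_add]
  push_cast
  ring

/-- For uniform `x`, the value `g x` is independent of the coordinate `x c`, so they agree with
probability at most one over the size of `X c`. Resampling that coordinate is injective on the
agreeing points, since the lost value can be recovered as `g x`. -/
theorem card_mul_card_le_of_update {κ : Type*} {X : κ → Type*} [Fintype κ] [DecidableEq κ]
    [∀ c, Fintype (X c)] (c : κ) (g : (∀ c, X c) → X c) (hg : ∀ x a, g (Function.update x c a) = g x) :
    (univ.filter fun x => x c = g x).card * Fintype.card (X c) ≤ Fintype.card (∀ c, X c) := by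
  rw [← Finset.card_univ (α := X c), ← Finset.card_product, ← Finset.card_univ]
  refine Finset.card_le_card_of_injOn (fun y => Function.update y.1 c y.2) (fun _ _ => mem_univ _) ?_
  rintro ⟨x, a⟩ hx ⟨y, a'⟩ hy h
  simp only [coe_product, Set.mem_prod, mem_coe, mem_filter, mem_univ, true_and, and_true] at hx hy h
  have ha : a = a' := by simpa using congrFun h c
  have hgxy : g x = g y := by
    rw [← hg x a, ← hg y a', h]
  have : x = y := by
    funext i
    by_cases hi : i = c
    · subst hi; rw [hx, hy, hgxy]
    · simpa [hi] using congrFun h i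
  rw [this, ha]

theorem IsPred.congr {ι C : Type*} [LinearOrder ι] {κ κ' : ι → C} {I : Finset ι} {q p : ι}
    (hκ : ∀ j ≤ p, κ j = κ' j) (h : IsPred κ I q p) : IsPred κ' I q p := by
  obtain ⟨hq, hp, hlt, he, hb⟩ := h
  refine ⟨hq, hp, hlt, by rw [← hκ q hlt.le, ← hκ p le_rfl, he], fun i hi h1 h2 => ?_⟩
  rw [← hκ i h2.le, ← hκ p le_rfl]
  exact hb i hi h1 h2

/-! ### Random words, their cells, and agreement in the next digit. -/

section Digits

variable {ι α β : Type*} {b k : ℕ} [Inhabited α] [Inhabited β]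

/-- Keep the first `s j` digits of the `j`-th word of `x`. -/
def truncateWords (s : Fin b → Fin k) (x : Fin b → Fin k → α) : Fin b → Fin k → α :=
  fun j l => if l < s j then x j l else default

/-- The class of a point, given by the first `s j` digits of its `j`-th word and the first `t`
digits of its last word. -/
def cell (s : Fin b → Fin k) (t : Fin k) (Y : ι → Fin b → Fin k → α) (z : Fin k → ι → β) (i : ι) :
    (Fin b → Fin k → α) × (Fin k → β) :=
  (truncateWords s (Y i), fun l => if l < t then z l i else default)

theorem cell_eq_iff {s : Fin b → Fin k} {t : Fin k} {Y : ι → Fin b → Fin k → α}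
    {z : Fin k → ι → β} {i i' : ι} : cell s t Y z i = cell s t Y z i' ↔
      (∀ j, ∀ l < s j, Y i j l = Y i' j l) ∧ ∀ l < t, z l i = z l i' := by
  simp only [cell, truncateWords, Prod.mk.injEq, funext_iff]
  refine and_congr (forall_congr' fun j => forall_congr' fun l => ?_) (forall_congr' fun l => ?_)
  · by_cases h : l < s j <;> simp [h]
  · by_cases h : l < t <;> simp [h]

theorem cell_congr {t : Fin k} {Y : ι → Fin b → Fin k → α} {z z' : Fin k → ι → β}
    (h : ∀ l < t, z l = z' l) (s : Fin b → Fin k) :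
    cell s t Y z = cell s t Y z' := by
  funext i
  simp only [cell, Prod.mk.injEq, true_and]
  funext l
  split_ifs with hl
  · rw [h l hl]
  · rfl

variable [Fintype ι] [LinearOrder ι]

/-- The predecessor of `p` depends on the digits of `p` only before position `s j` in word `j`, so
the digit at `s j` is still uniform. Agreement in some word has conditional probability at most `b /
E ^ 2 ≤ 1 / E`, and each point of `I` contributes a factor at most `1 + E * (1 / E) = 2`. -/
theorem sum_pow_card_agree_le [Fintype α] (I : Finset ι) (s : Fin b → Fin k) (t : Fin k)
    (z : Fin k → ι → β) (E : ℕ) (hE : 1 ≤ E) (hα : Fintype.card α = E ^ 2) (hb : b ≤ E) :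
    ∑ Y : ι → Fin b → Fin k → α, (E : ℝ) ^ (I.filter fun p =>
        ∃ q, IsPred (cell s t Y z) I q p ∧ ∃ j, Y q j (s j) = Y p j (s j)).card ≤
      2 ^ I.card * (Fintype.card (Fin b → Fin k → α) : ℝ) ^ Fintype.card ι := by
  set X := Fin b → Fin k → α with hX
  set Q : (ι → X) → ι → Prop := fun Y p => p ∈ I ∧
    ∃ q, IsPred (cell s t Y z) I q p ∧ ∃ j, Y q j (s j) = Y p j (s j) with hQ
  have hcell : ∀ (Y Y' : ι → X) (p : ι), (∀ j ≤ p, Y j = Y' j) →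
      ∀ j ≤ p, cell s t Y z j = cell s t Y' z j := by
    intro Y Y' p h j hj
    simp only [cell, h j hj]
  have hstep : ∀ (Y : ι → X) (p : ι),
      E * (univ.filter fun x => Q (Function.update Y p x) p).card ≤ Fintype.card X := by
    intro Y p
    set P : Fin b → X → Prop := fun j x => ∃ q, IsPred (cell s t (Function.update Y p x) z) I q p ∧
      Y q j (s j) = x j (s j) with hP
    have h1 : (univ.filter fun x => Q (Function.update Y p x) p) ⊆
        univ.biUnion fun j => univ.filter fun x => P j x := by
      intro x hx
      simp only [mem_filter, mem_univ, true_and, hQ, mem_biUnion, hP] at hx ⊢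
      obtain ⟨-, q, hq, j, hj⟩ := hx
      rw [Function.update_self, Function.update_of_ne hq.2.2.1.ne] at hj
      exact ⟨j, q, hq, hj⟩
    have h2 : ∀ j, (univ.filter fun x => P j x).card * E ^ 2 ≤ Fintype.card X := by
      intro j
      -- The predecessor as a function of the word tuple at `p`; the default `p` only makes it
      -- total.
      let pr : X → ι := fun x => if h : ∃ q, IsPred (cell s t (Function.update Y p x) z) I q p then
        h.choose else p
      have hpr : ∀ x x', truncateWords s x = truncateWords s x' → pr x = pr x' := by
        intro x x' hxx
        have hc : cell s t (Function.update Y p x) z = cell s t (Function.update Y p x') z := by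
          funext i
          by_cases hi : i = p
          · subst hi; simp [cell, hxx]
          · simp [cell, hi]
        simp only [pr, hc]
      let y : X → (Fin b × Fin k → α) := fun x c => x c.1 c.2
      have h3 := card_mul_card_le_of_update (κ := Fin b × Fin k) (X := fun _ => α) (j, s j)
        (fun x => Y (pr fun j l => x (j, l)) j (s j)) (by
          intro x a
          refine congrFun (congrFun (congrArg Y (hpr _ _ ?_)) _) _
          funext j' l
          simp only [truncateWords]
          split_ifs with hl
          · rw [Function.update_of_ne]
            rintro ⟨⟩
            exact lt_irrefl _ hl
          · rfl)
      rw [hα] at h3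
      have h4 : Fintype.card (Fin b × Fin k → α) = Fintype.card X :=
        Fintype.card_congr (Equiv.curry _ _ _)
      rw [h4] at h3
      refine le_trans (Nat.mul_le_mul_right _ ?_) h3
      refine Finset.card_le_card_of_injOn y ?_ ?_
      · intro x hx
        simp only [coe_filter, mem_univ, true_and, Set.mem_ofPred_eq, hP] at hx ⊢
        obtain ⟨q, hq, hj⟩ := hx
        have : pr x = q := by
          have h : ∃ q, IsPred (cell s t (Function.update Y p x) z) I q p := ⟨q, hq⟩
          simp only [pr, h, dif_pos]
          exact h.choose_spec.left_unique hq
        change x j (s j) = Y (pr x) j (s j)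
        rw [this, hj]
      · intro x _ x' _ h
        funext j l
        exact congrFun h (j, l)
    have h5 : (univ.filter fun x => Q (Function.update Y p x) p).card * E ^ 2 ≤
        b * Fintype.card X := by
      calc _ ≤ (∑ j : Fin b, (univ.filter fun x => P j x).card) * E ^ 2 :=
            Nat.mul_le_mul_right _ ((card_le_card h1).trans card_biUnion_le)
        _ = ∑ j : Fin b, (univ.filter fun x => P j x).card * E ^ 2 := Finset.sum_mul ..
        _ ≤ ∑ j : Fin b, Fintype.card X := Finset.sum_le_sum fun j _ => h2 j
        _ = _ := by simp
    have h6 : E * (E * (univ.filter fun x => Q (Function.update Y p x) p).card) ≤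
        E * Fintype.card X := by
      calc _ = (univ.filter fun x => Q (Function.update Y p x) p).card * E ^ 2 := by ring
        _ ≤ _ := h5.trans (Nat.mul_le_mul_right _ hb)
    exact Nat.le_of_mul_le_mul_left h6 hE
  have main := sum_prod_le_prod (ι := ι) (X := X) (fun p Y => if Q Y p then (E : ℝ) else 1)
    (fun p => if p ∈ I then 2 * (Fintype.card X : ℝ) else Fintype.card X)
    (fun p Y => by positivity)
    (by
      intro p Y Y' h
      have : ∀ Y Y' : ι → X, (∀ j ≤ p, Y j = Y' j) → Q Y p → Q Y' p := by
        rintro Y Y' h ⟨hp, q, hq, j, hj⟩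
        exact ⟨hp, q, hq.congr (hcell _ _ _ h), j, by rw [← h p le_rfl, ← h q hq.2.2.1.le, hj]⟩
      have : Q Y p ↔ Q Y' p := ⟨this _ _ h, this _ _ fun j hj => (h j hj).symm⟩
      simp only [this])
    (by
      intro p Y
      by_cases hp : p ∈ I
      · have h1 : ∀ x : X, (if Q (Function.update Y p x) p then (E : ℝ) else 1) ≤
            1 + E * if Q (Function.update Y p x) p then 1 else 0 := by
          intro x; split_ifs <;> simp
        refine (Finset.sum_le_sum fun x _ => h1 x).trans ?_
        rw [Finset.sum_add_distrib, ← Finset.mul_sum, Finset.sum_boole]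
        simp only [hp, if_true, sum_const, card_univ, nsmul_eq_mul, mul_one]
        have h2 : (E : ℝ) * ((univ.filter fun x => Q (Function.update Y p x) p).card : ℝ) ≤
            Fintype.card X := by exact_mod_cast hstep Y p
        linarith
      · have h1 : ∀ x, ¬ Q (Function.update Y p x) p := fun x h => hp h.1
        simp [h1, hp])
  refine le_trans (le_of_eq ?_) (main.trans (le_of_eq ?_))
  · refine Finset.sum_congr rfl fun Y _ => ?_
    rw [Finset.prod_ite, Finset.prod_const, Finset.prod_const_one, mul_one]
    congr 2
    ext p
    simp [hQ]
  · have : ∀ p, (if p ∈ I then 2 * (Fintype.card X : ℝ) else Fintype.card X) =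
        (if p ∈ I then 2 else 1) * (Fintype.card X : ℝ) := by
      intro p; split_ifs <;> ring
    simp_rw [this]
    rw [Finset.prod_mul_distrib, Finset.prod_const, Finset.prod_ite, Finset.card_univ]
    simp [hX]

/-- There are few assignments of words for which at least a quarter of the points of `I` agree with
their predecessor in the next digit of some word. -/
theorem card_many_agree_le [Fintype α] (I : Finset ι) (s : Fin b → Fin k) (t : Fin k)
    (z : Fin k → ι → β) (T : ℕ) (hT : 1 ≤ T) (hα : Fintype.card α = T ^ 8) (hb : b ≤ T ^ 4) :
    (T : ℝ) ^ I.card * ((univ.filter fun Y : ι → Fin b → Fin k → α =>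
        I.card ≤ 4 * (I.filter fun p => ∃ q, IsPred (cell s t Y z) I q p ∧
          ∃ j, Y q j (s j) = Y p j (s j)).card).card : ℝ) ≤
      2 ^ I.card * (Fintype.card (ι → Fin b → Fin k → α) : ℝ) := by
  have h := sum_pow_card_agree_le (α := α) I s t z (T ^ 4) (Nat.one_le_pow _ _ hT)
    (by rw [hα]; ring) hb
  rw [Fintype.card_fun (α := ι)]
  push_cast at h ⊢
  refine le_trans ?_ h
  rw [mul_comm, ← nsmul_eq_mul, ← Finset.sum_const]
  refine le_trans (Finset.sum_le_sum (g := fun Y => ((T : ℝ) ^ 4) ^ (I.filter fun p =>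
    ∃ q, IsPred (cell s t Y z) I q p ∧ ∃ j, Y q j (s j) = Y p j (s j)).card) fun Y hY => ?_)
    (Finset.sum_le_univ_sum_of_nonneg fun Y => by positivity)
  rw [← pow_mul]
  exact pow_le_pow_right₀ (by exact_mod_cast hT) (by simpa using hY)

end Digits

/-! ### Edges at all scales and the chance that a time step uses none. -/

section Digits

variable {ι α β : Type*} {b k : ℕ} [Inhabited α] [Inhabited β] [Fintype ι] [LinearOrder ι]

/-- `q` and `p` are consecutive points of `I` in their cell at scale `s` and time `t`, with at most
`L` points of the cell between them, and they are separated by the next digits of all words. -/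
def ScaleEdge (L : ℕ) (I : Finset ι) (s : Fin b → Fin k) (t : Fin k) (Y : ι → Fin b → Fin k → α)
    (z : Fin k → ι → β) (q p : ι) : Prop :=
  IsPred (cell s t Y z) I q p ∧ (between (cell s t Y z) q p).card ≤ L ∧
    ∀ j, Y q j (s j) ≠ Y p j (s j)

/-- The pairs which form an edge at some scale. -/
def Edge (L : ℕ) (I : Finset ι) (t : Fin k) (Y : ι → Fin b → Fin k → α)
    (z : Fin k → ι → β) (q p : ι) : Prop :=
  ∃ s : Fin b → Fin k, ScaleEdge L I s t Y z q p

variable {L : ℕ} {I : Finset ι} {t : Fin k} {Y : ι → Fin b → Fin k → α} {z : Fin k → ι → β}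

/-- If `s j < s' j`, being in one cell at scale `s'` forces equality of digit `s j` in word `j`,
which an edge at scale `s` excludes. -/
theorem ScaleEdge.scale_unique {s s' : Fin b → Fin k} {q p : ι}
    (h : ScaleEdge L I s t Y z q p) (h' : ScaleEdge L I s' t Y z q p) : s = s' := by
  have key : ∀ s s' : Fin b → Fin k, ScaleEdge L I s t Y z q p → ScaleEdge L I s' t Y z q p →
      ∀ j, ¬ s j < s' j := by
    intro s s' h h' j hlt
    exact h.2.2 j ((cell_eq_iff.1 h'.1.2.2.2.1).1 j _ hlt)
  funext j
  exact le_antisymm (not_lt.1 (key _ _ h' h j)) (not_lt.1 (key _ _ h h' j))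

/-- Each scale provides at most one predecessor. -/
theorem card_edge_left_le (p : ι) :
    (univ.filter fun q => Edge L I t Y z q p).card ≤ k ^ b := by
  have hch : ∀ q ∈ univ.filter fun q => Edge L I t Y z q p,
      ∃ s : Fin b → Fin k, ScaleEdge L I s t Y z q p := fun q hq => (mem_filter.1 hq).2
  have : Nonempty (Fin b → Fin k) := ⟨fun _ => t⟩
  choose! g hg using hch
  calc _ ≤ (univ : Finset (Fin b → Fin k)).card :=
        Finset.card_le_card_of_injOn g (fun _ _ => mem_univ _) fun q hq q' hq' h => by
          have h1 := hg q hq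
          have h2 := hg q' hq'
          rw [h] at h1
          exact h1.1.left_unique h2.1
    _ = _ := by simp

theorem card_edge_right_le (q : ι) :
    (univ.filter fun p => Edge L I t Y z q p).card ≤ k ^ b := by
  have hch : ∀ p ∈ univ.filter fun p => Edge L I t Y z q p,
      ∃ s : Fin b → Fin k, ScaleEdge L I s t Y z q p := fun p hp => (mem_filter.1 hp).2
  have : Nonempty (Fin b → Fin k) := ⟨fun _ => t⟩
  choose! g hg using hch
  calc _ ≤ (univ : Finset (Fin b → Fin k)).card :=
        Finset.card_le_card_of_injOn g (fun _ _ => mem_univ _) fun p hp p' hp' h => by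
          have h1 := hg p hp
          have h2 := hg p' hp'
          rw [h] at h1
          exact h1.1.right_unique h2.1
    _ = _ := by simp

theorem pow_mul_le_card_edge (M : ℕ)
    (hM : ∀ s : Fin b → Fin k, M ≤ (I.filter fun p => ∃ q, ScaleEdge L I s t Y z q p).card) :
    k ^ b * M ≤ (univ.filter fun e : ι × ι => Edge L I t Y z e.1 e.2).card := by
  set T : Finset (Σ _ : Fin b → Fin k, ι) :=
    univ.sigma fun s => I.filter fun p => ∃ q, ScaleEdge L I s t Y z q p with hT
  have h1 : k ^ b * M ≤ T.card := by
    rw [hT, Finset.card_sigma]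
    calc k ^ b * M = ∑ _s : Fin b → Fin k, M := by simp
      _ ≤ _ := Finset.sum_le_sum fun s _ => hM s
  rcases T.eq_empty_or_nonempty with hemp | ⟨⟨-, p₀⟩, -⟩
  · rw [hemp, card_empty] at h1
    exact h1.trans (Nat.zero_le _)
  have : Nonempty ι := ⟨p₀⟩
  have hch : ∀ e ∈ T, ∃ q, ScaleEdge L I e.1 t Y z q e.2 := fun e he =>
    (mem_filter.1 (mem_sigma.1 he).2).2
  choose! g hg using hch
  refine h1.trans (Finset.card_le_card_of_injOn (fun e => (g e, e.2))
    (fun e he => mem_filter.2 ⟨mem_univ _, e.1, hg e he⟩) ?_)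
  rintro ⟨s, p⟩ he ⟨s', p'⟩ he' h
  have e1 := hg _ he
  have e2 := hg _ he'
  simp only [Prod.mk.injEq] at h
  rw [h.1] at e1
  obtain rfl : p = p' := h.2
  obtain rfl := e1.scale_unique e2
  rfl

variable [Fintype β]

/-- The cells and the long gaps cost at most an eighth of `I` each, and agreement in a next digit
less than a quarter. -/
theorem half_le_card_scaleEdge [Fintype α] (s : Fin b → Fin k) (hL : 0 < L)
    (hC : 8 * (Fintype.card α ^ (k * b) * Fintype.card β ^ k) ≤ I.card)
    (hn : 8 * Fintype.card ι ≤ L * I.card)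
    (hagree : 4 * (I.filter fun p => ∃ q, IsPred (cell s t Y z) I q p ∧
          ∃ j, Y q j (s j) = Y p j (s j)).card < I.card) :
    I.card ≤ 2 * (I.filter fun p => ∃ q, ScaleEdge L I s t Y z q p).card := by
  have h1 := mul_card_le_isPred (cell s t Y z) I L
  set a := (I.filter fun p => ∃ q, IsPred (cell s t Y z) I q p ∧
    (between (cell s t Y z) q p).card ≤ L).card with ha
  have hcard : Fintype.card ((Fin b → Fin k → α) × (Fin k → β)) =
      Fintype.card α ^ (k * b) * Fintype.card β ^ k := by
    simp [pow_mul]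
  rw [hcard] at h1
  have h2 : a ≤ (I.filter fun p => ∃ q, ScaleEdge L I s t Y z q p).card +
      (I.filter fun p => ∃ q, IsPred (cell s t Y z) I q p ∧ ∃ j, Y q j (s j) = Y p j (s j)).card := by
    refine le_trans (Finset.card_le_card ?_) (Finset.card_union_le _ _)
    intro p hp
    obtain ⟨hpI, q, hq, hb⟩ := mem_filter.1 hp
    by_cases h : ∃ j, Y q j (s j) = Y p j (s j)
    · exact mem_union_right _ (mem_filter.2 ⟨hpI, q, hq, h⟩)
    · exact mem_union_left _ (mem_filter.2 ⟨hpI, q, hq, hb, not_exists.1 h⟩)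
  have h3 : L * (3 * I.card) ≤ L * (4 * a) := by
    have := Nat.mul_le_mul_left L hC
    nlinarith
  have h4 := Nat.le_of_mul_le_mul_left h3 hL
  omega

/-- The colours which make an edge `(q, p)` monochromatic without using a colour of a point between
`q` and `p` in the cell of the edge. -/
noncomputable def allowed (L : ℕ) (I : Finset ι) (t : Fin k) (Y : ι → Fin b → Fin k → α)
    (z : Fin k → ι → β) (w : ι → β) (q p : ι) : Finset β :=
  univ.filter fun c => ∃ s, ScaleEdge L I s t Y z q p ∧ ∀ i ∈ between (cell s t Y z) q p, w i ≠ c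

/-- No edge at time `t` is monochromatic in an allowed colour, and there are at least `e` edges. -/
def Avoids (L e : ℕ) (I : Finset ι) (Y : ι → Fin b → Fin k → α) (t : Fin k)
    (z : Fin k → ι → β) : Prop :=
  e ≤ (univ.filter fun e : ι × ι => Edge L I t Y z e.1 e.2).card ∧
    ∀ q p, z t q ∈ allowed L I t Y z (z t) q p → z t p ≠ z t q

/-- Cells at time `t` see only colours from earlier times, so resampling `z t` leaves the edges
unchanged. Points of the cell strictly between the ends of an edge lie outside `I`, so the allowed
lists depend only on colours outside `I`; at most `L` of the colours are excluded. -/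
theorem card_avoids_step_le (e : ℕ) (Y : ι → Fin b → Fin k → α) (t : Fin k) (z : Fin k → ι → β)
    (hL : 2 * L ≤ Fintype.card β) (hk : 8 * k ^ b ≤ Fintype.card β) :
    ((univ.filter fun w => Avoids L e I Y t (Function.update z t w)).card : ℝ) ≤
      (Fintype.card β : ℝ) ^ Fintype.card ι *
        Real.exp (-(e : ℝ) / (8 * Fintype.card β)) := by
  have hcell : ∀ w s, cell s t Y (Function.update z t w) = cell s t Y z := fun w s =>
    cell_congr (fun l hl => Function.update_of_ne hl.ne _ _) s
  have hSE : ∀ w s q p, ScaleEdge L I s t Y (Function.update z t w) q p ↔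
      ScaleEdge L I s t Y z q p := by
    intro w s q p
    simp only [ScaleEdge, hcell]
  have hE : ∀ w q p, Edge L I t Y (Function.update z t w) q p ↔ Edge L I t Y z q p := by
    intro w q p
    simp only [Edge, hSE]
  have hAl : ∀ w w' q p, allowed L I t Y (Function.update z t w) w' q p =
      allowed L I t Y z w' q p := by
    intro w w' q p
    simp only [allowed, hSE, hcell]
  by_cases he : e ≤ (univ.filter fun e : ι × ι => Edge L I t Y z e.1 e.2).card
  · have h1 := card_coloring_le_of_subset I (fun w => allowed L I t Y z w) (Edge L I t Y z)
      (by
        intro w w' h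
        funext q p
        ext c
        simp only [allowed, mem_filter, mem_univ, true_and]
        refine exists_congr fun s => and_congr_right fun hs => forall₂_congr fun i hi => ?_
        rw [h i]
        intro hiI
        simp only [between, mem_filter, mem_univ, true_and] at hi
        exact hs.1.2.2.2.2 i hiI hi.1 hi.2.1 hi.2.2)
      (fun q p ⟨s, hs⟩ => ⟨hs.1.1, hs.1.2.1⟩) (fun q p ⟨s, hs⟩ => hs.1.2.2.1)
      (by
        rintro w q p ⟨s, hs⟩
        have h2 : univ \ (between (cell s t Y z) q p).image w ⊆ allowed L I t Y z w q p := by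
          intro c hc
          simp only [mem_sdiff, mem_univ, true_and, mem_image, not_exists, not_and] at hc
          exact mem_filter.2 ⟨mem_univ _, s, hs, hc⟩
        have h3 := card_le_card h2
        have h4 := Finset.le_card_sdiff ((between (cell s t Y z) q p).image w) (univ : Finset β)
        have h5 : ((between (cell s t Y z) q p).image w).card ≤ L :=
          Finset.card_image_le.trans hs.2.1
        rw [Finset.card_univ] at h4
        omega)
      (by
        intro w q p h
        simp only [allowed]
        refine Finset.filter_eq_empty_iff.2 fun c _ => ?_
        rintro ⟨s, hs, -⟩
        exact h ⟨s, hs⟩)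
      (fun p => (Nat.mul_le_mul_left 8 (card_edge_left_le p)).trans hk)
      (fun q => (card_edge_right_le q).trans (by omega))
    refine le_trans ?_ (h1.trans (mul_le_mul_of_nonneg_left ?_ (by positivity)))
    · refine Nat.cast_le.2 (Finset.card_le_card ?_)
      intro w hw
      simp only [mem_filter, mem_univ, true_and, Avoids, Function.update_self, hAl] at hw ⊢
      exact hw.2
    · refine Real.exp_le_exp.2 ?_
      gcongr
  · have : (univ.filter fun w => Avoids L e I Y t (Function.update z t w)) = ∅ := by
      refine Finset.filter_eq_empty_iff.2 fun w _ h => he ?_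
      simpa only [hE] using h.1
    rw [this]
    simp only [card_empty, Nat.cast_zero]
    positivity

theorem card_forall_avoids_le (I : Finset ι) (e : ℕ) (Y : ι → Fin b → Fin k → α)
    (hL : 2 * L ≤ Fintype.card β) (hk : 8 * k ^ b ≤ Fintype.card β) :
    ((univ.filter fun z : Fin k → ι → β => ∀ t, Avoids L e I Y t z).card : ℝ) ≤
      (Fintype.card (Fin k → ι → β) : ℝ) * Real.exp (-(k * e : ℝ) / (8 * Fintype.card β)) := by
  have main := sum_prod_le_prod (ι := Fin k) (X := ι → β)
    (fun t z => if Avoids L e I Y t z then 1 else 0)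
    (fun _ => (Fintype.card β : ℝ) ^ Fintype.card ι *
        Real.exp (-(e : ℝ) / (8 * Fintype.card β)))
    (fun t z => by positivity)
    (by
      intro t z z' h
      have hcell : ∀ s, cell s t Y z = cell s t Y z' := cell_congr fun l hl => h l hl.le
      have hiff : Avoids L e I Y t z ↔ Avoids L e I Y t z' := by
        have hSE : ∀ s q p, ScaleEdge L I s t Y z q p ↔ ScaleEdge L I s t Y z' q p := by
          intro s q p
          simp only [ScaleEdge, hcell]
        have hE : ∀ q p, Edge L I t Y z q p ↔ Edge L I t Y z' q p := by
          intro q p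
          simp only [Edge, hSE]
        have hA : allowed L I t Y z = allowed L I t Y z' := by
          funext w q p
          ext c
          simp only [allowed, mem_filter, hSE, hcell]
        simp only [Avoids, hE, hA, h t le_rfl]
      simp only [hiff])
    (by
      intro t z
      rw [Finset.sum_boole]
      exact card_avoids_step_le e Y t z hL hk)
  rw [Finset.prod_const, mul_pow, ← Real.exp_nat_mul] at main
  refine le_trans (le_of_eq ?_) (main.trans (le_of_eq ?_))
  · rw [Finset.cast_card, Finset.sum_filter]
    refine Finset.sum_congr rfl fun z _ => ?_
    by_cases h : ∀ t, Avoids L e I Y t z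
    · simp [h]
    · rw [if_neg h]
      obtain ⟨t, ht⟩ := not_forall.1 h
      exact (Finset.prod_eq_zero (mem_univ t) (by simp [ht])).symm
  · simp only [card_univ, Fintype.card_fin, Fintype.card_fun, Nat.cast_pow]
    congr 2
    ring

end Digits
-- The union bound over all `m`-element sets.
theorem exists_words_separating {α β : Type*} [Inhabited α] [Inhabited β] [Fintype α] [Fintype β]
    {n m k b L T : ℕ} (hT : 1 ≤ T) (hα : Fintype.card α = T ^ 8) (hβ : Fintype.card β = 2 * L)
    (hb : b ≤ T ^ 4) (hk : 8 * k ^ b ≤ 2 * L)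
    (hC : 8 * ((T ^ 8) ^ (k * b) * (2 * L) ^ k) ≤ m) (hn : 8 * n ≤ L * m)
    (H : (n.choose m : ℝ) * ((k : ℝ) ^ (b + 1) * (2 / T) ^ m +
      Real.exp (-((k : ℝ) ^ (b + 1) * m) / (32 * L))) < 1) :
    ∃ (Y : Fin n → Fin b → Fin k → α) (z : Fin k → Fin n → β), ∀ I : Finset (Fin n), I.card = m →
      ∃ q ∈ I, ∃ p ∈ I, q < p ∧ ∃ (s : Fin b → Fin k) (t : Fin k),
        ((∀ j, ∀ l < s j, Y q j l = Y p j l) ∧ ∀ l ≤ t, z l q = z l p) ∧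
        ∀ i, q < i → i < p →
          ¬ ((∀ j, ∀ l < s j, Y i j l = Y p j l) ∧ ∀ l ≤ t, z l i = z l p) := by
  set 𝒴 := Fin n → Fin b → Fin k → α
  set 𝒵 := Fin k → Fin n → β
  have hL : 0 < L := by
    have : 0 < Fintype.card β := Fintype.card_pos
    omega
  have hT0 : (0 : ℝ) < T := by exact_mod_cast hT
  set e₀ := k ^ b * ((m + 1) / 2) with he₀
  set agreeing : Finset (Fin n) → (Fin b → Fin k) → Fin k → 𝒵 → Finset 𝒴 := fun I s t z =>
    univ.filter fun Y => I.card ≤ 4 * (I.filter fun p => ∃ q, IsPred (cell s t Y z) I q p ∧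
          ∃ j, Y q j (s j) = Y p j (s j)).card with hagreeing
  set bad : Finset (Fin n) → Finset (𝒴 × 𝒵) := fun I => univ.filter fun ω =>
    (∃ t s, ω.1 ∈ agreeing I s t ω.2) ∨ ∀ t, Avoids L e₀ I ω.1 t ω.2 with hbad
  have hbadcard : ∀ I : Finset (Fin n), I.card = m → ((bad I).card : ℝ) ≤
      (Fintype.card (𝒴 × 𝒵) : ℝ) * ((k : ℝ) ^ (b + 1) * (2 / T) ^ m +
        Real.exp (-((k : ℝ) ^ (b + 1) * m) / (32 * L))) := by
    intro I hI
    have hsub : bad I ⊆ ((univ : Finset (Fin k × (Fin b → Fin k))).biUnion fun e =>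
        univ.filter fun ω : 𝒴 × 𝒵 => ω.1 ∈ agreeing I e.2 e.1 ω.2) ∪
        univ.filter fun ω : 𝒴 × 𝒵 => ∀ t, Avoids L e₀ I ω.1 t ω.2 := by
      intro ω hω
      rcases (mem_filter.1 hω).2 with ⟨t, s, h⟩ | h
      · exact mem_union_left _ (mem_biUnion.2 ⟨(t, s), mem_univ _, mem_filter.2 ⟨mem_univ _, h⟩⟩)
      · exact mem_union_right _ (mem_filter.2 ⟨mem_univ _, h⟩)
    have h1 : ∀ e : Fin k × (Fin b → Fin k), ((univ.filter fun ω : 𝒴 × 𝒵 =>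
        ω.1 ∈ agreeing I e.2 e.1 ω.2).card : ℝ) ≤ Fintype.card (𝒴 × 𝒵) * (2 / T) ^ m := by
      intro e
      rw [Finset.cast_card, Finset.sum_filter, Fintype.sum_prod_type_right]
      have : ∀ z : 𝒵, ∑ Y : 𝒴, (if Y ∈ agreeing I e.2 e.1 z then (1 : ℝ) else 0) ≤
          Fintype.card 𝒴 * (2 / T) ^ m := by
        intro z
        have h2 := card_many_agree_le (α := α) I e.2 e.1 z T hT hα hb
        rw [hI] at h2
        simp only [Finset.sum_ite_mem, univ_inter, sum_const, nsmul_eq_mul, mul_one]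
        rw [div_pow, mul_div_assoc', le_div_iff₀ (by positivity)]
        rw [mul_comm] at h2
        refine le_trans (le_of_eq ?_) (h2.trans (le_of_eq (mul_comm _ _)))
        simp only [hagreeing, hI]
        congr!
      refine (Finset.sum_le_sum fun z _ => this z).trans (le_of_eq ?_)
      rw [Finset.sum_const, Finset.card_univ, nsmul_eq_mul, Fintype.card_prod]
      push_cast
      ring
    have h3 : ((univ.filter fun ω : 𝒴 × 𝒵 => ∀ t, Avoids L e₀ I ω.1 t ω.2).card : ℝ) ≤
        Fintype.card (𝒴 × 𝒵) * Real.exp (-((k : ℝ) ^ (b + 1) * m) / (32 * L)) := by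
      rw [Finset.cast_card, Finset.sum_filter, Fintype.sum_prod_type]
      have : ∀ Y : 𝒴, ∑ z : 𝒵, (if ∀ t, Avoids L e₀ I Y t z then (1 : ℝ) else 0) ≤
          Fintype.card 𝒵 * Real.exp (-((k : ℝ) ^ (b + 1) * m) / (32 * L)) := by
        intro Y
        have h2 := card_forall_avoids_le (L := L) (β := β) I e₀ Y hβ.ge (hβ ▸ hk)
        rw [Finset.sum_boole]
        refine h2.trans (mul_le_mul_of_nonneg_left ?_ (by positivity))
        refine Real.exp_le_exp.2 ?_
        rw [hβ]
        have h4 : (k : ℝ) ^ (b + 1) * m ≤ 2 * (k * e₀) := by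
          have : m ≤ 2 * ((m + 1) / 2) := by omega
          have h5 : k ^ (b + 1) * m ≤ 2 * (k * e₀) := by
            calc k ^ (b + 1) * m ≤ k ^ (b + 1) * (2 * ((m + 1) / 2)) := Nat.mul_le_mul_left _ this
              _ = _ := by rw [he₀]; ring
          exact_mod_cast h5
        have hL0 : (0 : ℝ) < L := by exact_mod_cast hL
        rw [div_le_div_iff₀ (by positivity) (by positivity)]
        push_cast
        nlinarith
      refine (Finset.sum_le_sum fun z _ => this z).trans (le_of_eq ?_)
      rw [Finset.sum_const, Finset.card_univ, nsmul_eq_mul, Fintype.card_prod]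
      push_cast
      ring
    have h4 : ((bad I).card : ℝ) ≤ (∑ e : Fin k × (Fin b → Fin k), ((univ.filter fun ω : 𝒴 × 𝒵 =>
        ω.1 ∈ agreeing I e.2 e.1 ω.2).card : ℝ)) +
        ((univ.filter fun ω : 𝒴 × 𝒵 => ∀ t, Avoids L e₀ I ω.1 t ω.2).card : ℝ) := by
      have := (card_le_card hsub).trans ((card_union_le _ _).trans
        (Nat.add_le_add_right card_biUnion_le _))
      exact_mod_cast this
    refine h4.trans ((add_le_add (Finset.sum_le_sum fun e _ => h1 e) h3).trans (le_of_eq ?_))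
    rw [Finset.sum_const, Finset.card_univ, nsmul_eq_mul]
    simp only [Fintype.card_prod, Fintype.card_fin, Fintype.card_fun]
    push_cast
    ring
  have hΩ : 0 < (Fintype.card (𝒴 × 𝒵) : ℝ) := by exact_mod_cast Fintype.card_pos
  have htotal : (((powersetCard m (univ : Finset (Fin n))).biUnion bad).card : ℝ) <
      Fintype.card (𝒴 × 𝒵) := by
    calc (((powersetCard m (univ : Finset (Fin n))).biUnion bad).card : ℝ)
        ≤ ∑ I ∈ powersetCard m (univ : Finset (Fin n)), ((bad I).card : ℝ) := by
          exact_mod_cast card_biUnion_le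
      _ ≤ ∑ I ∈ powersetCard m (univ : Finset (Fin n)), (Fintype.card (𝒴 × 𝒵) : ℝ) *
          ((k : ℝ) ^ (b + 1) * (2 / T) ^ m +
            Real.exp (-((k : ℝ) ^ (b + 1) * m) / (32 * L))) :=
          Finset.sum_le_sum fun I hI => hbadcard I (mem_powersetCard.1 hI).2
      _ = (Fintype.card (𝒴 × 𝒵) : ℝ) * ((n.choose m : ℝ) * ((k : ℝ) ^ (b + 1) * (2 / T) ^ m +
            Real.exp (-((k : ℝ) ^ (b + 1) * m) / (32 * L)))) := by
          rw [Finset.sum_const, card_powersetCard, card_univ, Fintype.card_fin, nsmul_eq_mul]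
          ring
      _ < (Fintype.card (𝒴 × 𝒵) : ℝ) * 1 := mul_lt_mul_of_pos_left H hΩ
      _ = _ := mul_one _
  obtain ⟨⟨Y, z⟩, hω⟩ : ∃ ω, ω ∉ (powersetCard m (univ : Finset (Fin n))).biUnion bad := by
    by_contra! h
    rw [Finset.eq_univ_of_forall h, card_univ] at htotal
    exact lt_irrefl _ htotal
  refine ⟨Y, z, fun I hI => ?_⟩
  have hgood : (Y, z) ∉ bad I := fun h => hω (mem_biUnion.2
    ⟨I, mem_powersetCard.2 ⟨subset_univ _, hI⟩, h⟩)
  simp only [hbad, hagreeing, mem_filter, mem_univ, true_and, not_or, not_exists, not_forall, not_le]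
    at hgood
  obtain ⟨hag, t, ht⟩ := hgood
  have hedge : e₀ ≤ (univ.filter fun e : Fin n × Fin n => Edge L I t Y z e.1 e.2).card := by
    refine pow_mul_le_card_edge _ fun s => ?_
    have := half_le_card_scaleEdge (I := I) (Y := Y) (z := z) (t := t) s hL
      (by rw [hα, hβ, hI]; exact hC) (by rw [Fintype.card_fin, hI]; exact hn)
      (lt_of_eq_of_lt (by congr!) (hag t s))
    omega
  have hmono : ∃ q p, z t q ∈ allowed L I t Y z (z t) q p ∧ z t p = z t q := by
    by_contra! h
    exact ht ⟨hedge, h⟩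
  obtain ⟨q, p, hA, heq⟩ := hmono
  simp only [allowed, mem_filter, mem_univ, true_and] at hA
  obtain ⟨s, hs, hbt⟩ := hA
  refine ⟨q, hs.1.1, p, hs.1.2.1, hs.1.2.2.1, s, t, ?_, ?_⟩
  · obtain ⟨h1, h2⟩ := cell_eq_iff.1 hs.1.2.2.2.1
    refine ⟨h1, fun l hl => ?_⟩
    rcases hl.lt_or_eq with hl | rfl
    · exact h2 l hl
    · exact heq.symm
  · rintro i hqi hip ⟨h1, h2⟩
    have hcell : cell s t Y z i = cell s t Y z p := cell_eq_iff.2 ⟨h1, fun l hl => h2 l hl.le⟩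
    -- A point sharing all prefixes through digit `t` would lie in the cell and carry the common
    -- colour, which is not allowed.
    refine hbt i ?_ ((h2 t le_rfl).trans heq)
    simp [between, hqi, hip, hcell]

end Counting

/-! ### From words to points and boxes. -/

section Geometry

theorem delaunayGraph_axisParallelBoxes_adj {d : ℕ} {P : Set (Fin d → ℝ)} {x y : P} (hxy : x ≠ y)
    (h : ∀ v ∈ P, (∀ c, v c ∈ Set.uIcc ((x : Fin d → ℝ) c) ((y : Fin d → ℝ) c)) →
      v = x ∨ v = y) :
    (delaunayGraph (axisParallelBoxes d) P).Adj x y := by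
  refine ⟨hxy, Set.univ.pi fun c => Set.uIcc ((x : Fin d → ℝ) c) ((y : Fin d → ℝ) c),
    ⟨fun c => (x : Fin d → ℝ) c ⊓ (y : Fin d → ℝ) c, fun c => (x : Fin d → ℝ) c ⊔ (y : Fin d → ℝ) c,
      fun c => inf_le_sup, rfl⟩, ?_⟩
  ext v
  constructor
  · rintro ⟨hv, hP⟩
    exact h v hP fun c => hv c (Set.mem_univ c)
  · rintro (rfl | rfl)
    · exact ⟨fun c _ => Set.left_mem_uIcc, x.2⟩
    · exact ⟨fun c _ => Set.right_mem_uIcc, y.2⟩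

/-- Words can be mapped to the line so that words with a common prefix of a given length form an
interval. -/
theorem exists_word_embedding (k : ℕ) (α : Type*) [LinearOrder α] [Fintype α] :
    ∃ f : (Fin k → α) → ℝ, ∀ (t : ℕ) (u v w : Fin k → α),
      (∀ l : Fin k, (l : ℕ) < t → u l = w l) → f v ∈ Set.uIcc (f u) (f w) →
        ∀ l : Fin k, (l : ℕ) < t → v l = w l := by
  obtain ⟨g⟩ : Nonempty (Lex (Fin k → α) ↪o ℝ) :=
    ⟨(Order.embedding_from_countable_to_dense (Lex (Fin k → α)) ℝ).some⟩
  -- Lexicographic comparison at the first digit not yet known to agree; applied on both sides of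
  -- `v`, it squeezes that digit.
  have hstep : ∀ (u v : Fin k → α) (l : Fin k), toLex u ≤ toLex v → (∀ i < l, u i = v i) →
      u l ≤ v l := by
    intro u v l huv hpre
    rcases huv.lt_or_eq with h | h
    · obtain ⟨i, hi, hlt⟩ := h
      rcases lt_trichotomy i l with h' | h' | h'
      · exact absurd (hpre i h') (ne_of_lt hlt)
      · subst h'; exact le_of_lt hlt
      · exact (hi l h').le
    · rw [toLex_inj.1 h]
  have key : ∀ (t : ℕ) (u v w : Fin k → α), (∀ l : Fin k, (l : ℕ) < t → u l = w l) →
      toLex u ≤ toLex v → toLex v ≤ toLex w → ∀ l : Fin k, (l : ℕ) < t → v l = w l := by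
    intro t u v w huw huv hvw l
    induction l using WellFoundedLT.induction with
    | _ l ih =>
      intro hl
      have hvw' : ∀ i < l, v i = w i := fun i hi => ih i hi (lt_trans hi hl)
      refine le_antisymm (hstep v w l hvw hvw') ?_
      rw [← huw l hl]
      exact hstep u v l huv fun i hi => by
        rw [huw i (lt_trans hi hl), hvw' i hi]
  refine ⟨fun u => g (toLex u), fun t u v w huw hv l hl => ?_⟩
  rcases Set.mem_uIcc.1 hv with ⟨h1, h2⟩ | ⟨h1, h2⟩
  · exact key t u v w huw (g.le_iff_le.1 h1) (g.le_iff_le.1 h2) l hl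
  · rw [key t w v u (fun l hl => (huw l hl).symm) (g.le_iff_le.1 h1) (g.le_iff_le.1 h2) l hl,
      huw l hl]

theorem exists_points_of_words {α β : Type*} [LinearOrder α] [LinearOrder β] [Fintype α] [Fintype β]
    {n m k b d : ℕ} (hbd : b + 2 ≤ d)
    (Y : Fin n → Fin b → Fin k → α) (z : Fin k → Fin n → β)
    (hYz : ∀ I : Finset (Fin n), I.card = m →
      ∃ q ∈ I, ∃ p ∈ I, q < p ∧ ∃ (s : Fin b → Fin k) (t : Fin k),
        ((∀ j, ∀ l < s j, Y q j l = Y p j l) ∧ ∀ l ≤ t, z l q = z l p) ∧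
        ∀ i, q < i → i < p →
          ¬ ((∀ j, ∀ l < s j, Y i j l = Y p j l) ∧ ∀ l ≤ t, z l i = z l p)) :
    ∃ P : Finset (Fin d → ℝ), P.card = n ∧
      (delaunayGraph (axisParallelBoxes d) (P : Set (Fin d → ℝ))).indepNum < m := by
  classical
  obtain ⟨f, hf⟩ := exists_word_embedding k α
  obtain ⟨g, hg⟩ := exists_word_embedding k β
  -- Only `b + 2` coordinates carry information: index, colour word, other words. The rest are zero.
  let pt : Fin n → Fin d → ℝ := fun i c =>
    if (c : ℕ) = 0 then (i : ℕ) else if (c : ℕ) = 1 then g (fun l => z l i) else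
      if h : (c : ℕ) - 2 < b then f (Y i ⟨(c : ℕ) - 2, h⟩) else 0
  have hpt0 : ∀ i, pt i ⟨0, by omega⟩ = (i : ℕ) := fun i => by simp [pt]
  have hpt1 : ∀ i, pt i ⟨1, by omega⟩ = g (fun l => z l i) := fun i => by simp [pt]
  have hpt2 : ∀ i (j : Fin b), pt i ⟨j + 2, by omega⟩ = f (Y i j) := fun i j => by simp [pt]
  have hinj : Function.Injective pt := by
    intro i i' h
    have := congrFun h ⟨0, by omega⟩
    rw [hpt0, hpt0] at this
    exact Fin.ext (by exact_mod_cast this)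
  refine ⟨Finset.univ.image pt, by rw [Finset.card_image_of_injective _ hinj]; simp, ?_⟩
  set P : Set (Fin d → ℝ) := ((Finset.univ.image pt : Finset (Fin d → ℝ)) : Set (Fin d → ℝ)) with hP
  have hmem : ∀ i, pt i ∈ P := fun i => by simp [hP]
  by_contra! hcon
  obtain ⟨S₀, hS₀⟩ := (delaunayGraph (axisParallelBoxes d) P).exists_isNIndepSet_indepNum
  obtain ⟨S, hSS, hS⟩ := Finset.exists_subset_card_eq (hcon.trans hS₀.card_eq.ge)
  set I : Finset (Fin n) := Finset.univ.filter fun i => (⟨pt i, hmem i⟩ : P) ∈ S with hI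
  have hIm : I.card = m := by
    rw [← hS]
    refine Finset.card_bij (fun i _ => ⟨pt i, hmem i⟩) (fun i hi => by simpa [hI] using hi) ?_ ?_
    · intro i _ i' _ h
      exact hinj (Subtype.mk.inj h)
    · rintro ⟨v, hv⟩ hvS
      obtain ⟨i, rfl⟩ : ∃ i, pt i = v := by simpa [hP] using hv
      exact ⟨i, by simpa [hI] using hvS, rfl⟩
  obtain ⟨q, hq, p, hp, hqp, s, t, ⟨hYa, hza⟩, hsep⟩ := hYz I hIm
  have hne : (⟨pt q, hmem q⟩ : P) ≠ ⟨pt p, hmem p⟩ := fun h =>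
    hqp.ne (hinj (Subtype.mk.inj h))
  refine hS₀.isIndepSet (hSS (by simpa [hI] using hq)) (hSS (by simpa [hI] using hp)) hne
    (delaunayGraph_axisParallelBoxes_adj hne ?_)
  intro v hv hbox
  obtain ⟨i, rfl⟩ : ∃ i, pt i = v := by simpa [hP] using hv
  have h0 := hbox ⟨0, by omega⟩
  have hle : ((q : ℕ) : ℝ) ≤ (p : ℕ) := by exact_mod_cast hqp.le
  simp only [hpt0, Set.uIcc_of_le hle, Set.mem_Icc, Nat.cast_le] at h0
  rcases h0.1.eq_or_lt with h1 | h1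
  · left; rw [Fin.ext h1]
  rcases h0.2.eq_or_lt with h2 | h2
  · right; rw [Fin.ext h2]
  refine absurd ⟨fun j l hl => ?_, fun l hl => ?_⟩ (hsep i h1 h2)
  · have h3 := hbox ⟨j + 2, by omega⟩
    simp only [hpt2] at h3
    exact hf (s j) _ _ _ (fun l hl => hYa j l hl) h3 l hl
  · have h3 := hbox ⟨1, by omega⟩
    simp only [hpt1] at h3
    -- The colour prefix includes digit `t`, hence length `t + 1`, whereas the other prefixes stop
    -- before `s j`.
    exact hg (t + 1) _ _ _ (fun l hl => hza l (Nat.lt_succ_iff.1 hl)) h3 l (Nat.lt_succ_iff.2 hl)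

end Geometry

/-! ### Choice of parameters and asymptotics. -/

section Parameters
open Filter Topology

/-- Stirling's lower bound gives at most `(exp 1 * n / m) ^ m`, and the factor `8` absorbs `exp 1`.
-/
theorem Nat.choose_le_pow_of_mul_le {n m L : ℕ} (hm : 0 < m) (h : 8 * n ≤ L * m) :
    (n.choose m : ℝ) ≤ (L : ℝ) ^ m := by
  have hm0 : (0 : ℝ) < m := by exact_mod_cast hm
  have h1 : (n.choose m : ℝ) ≤ (n : ℝ) ^ m / m.factorial := Nat.choose_le_pow_div m n
  have h2 := Real.pow_div_factorial_le_exp (m : ℝ) hm0.le m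
  have hf : (0 : ℝ) < m.factorial := by exact_mod_cast Nat.factorial_pos m
  have h3 : (n : ℝ) ≤ L * m / 8 := by
    have : (8 * n : ℝ) ≤ L * m := by exact_mod_cast h
    linarith
  have he : Real.exp (m : ℝ) ≤ 8 ^ m := by
    rw [← Real.exp_one_pow]
    exact pow_le_pow_left₀ (Real.exp_pos _).le (by linarith [Real.exp_one_lt_d9]) _
  calc (n.choose m : ℝ) ≤ (L * m / 8) ^ m / m.factorial :=
        h1.trans (by gcongr)
    _ = (L / 8) ^ m * ((m : ℝ) ^ m / m.factorial) := by
        rw [← mul_div_assoc, ← mul_pow]; congr 2; ring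
    _ ≤ (L / 8) ^ m * 8 ^ m := by gcongr; exact h2.trans he
    _ = (L : ℝ) ^ m := by rw [← mul_pow]; congr 1; ring

/-- With `T = L ^ 4`, the agreement term `(2 / T) ^ m` beats the `L ^ m` choices of `I` with enough
left over to absorb `k ^ (b + 1) ≤ L ^ 3`; `hlog` makes the other term at most `L ^ (-2 * m)`. -/
theorem exists_points_indepNum_lt {d n m k b L : ℕ} (hbd : b + 2 ≤ d) (hL : 4 ≤ L) (hbL : b ≤ L)
    (hkb : 4 * k ^ b ≤ L) (hk : k ≤ L ^ 2) (hm : 2 ≤ m)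
    (hC : 8 * L ^ (32 * (k * b) + 2 * k) ≤ m) (hn : 8 * n ≤ L * m)
    (hlog : 64 * (L : ℝ) * Real.log L ≤ (k : ℝ) ^ (b + 1)) :
    ∃ P : Finset (Fin d → ℝ), P.card = n ∧
      (delaunayGraph (axisParallelBoxes d) (P : Set (Fin d → ℝ))).indepNum < m := by
  have : NeZero ((L ^ 4) ^ 8) := ⟨by positivity⟩
  have : NeZero (2 * L) := ⟨by omega⟩
  have hLR : (4 : ℝ) ≤ L := by exact_mod_cast hL
  have hL0 : (0 : ℝ) < L := by linarith
  obtain ⟨Y, z, h⟩ := exists_words_separating (α := Fin ((L ^ 4) ^ 8)) (β := Fin (2 * L))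
    (n := n) (m := m) (k := k) (b := b) (L := L) (T := L ^ 4) (Nat.one_le_pow _ _ (by omega))
    (by simp) (by simp) (hbL.trans (by
      rw [← pow_mul]; exact Nat.le_self_pow (by norm_num) L)) (by omega)
    (by
      refine le_trans ?_ hC
      have h32 : ((L ^ 4) ^ 8) ^ (k * b) = L ^ (32 * (k * b)) := by
        rw [← pow_mul, ← pow_mul]
        congr 1
        ring
      have h2 : 2 * L ≤ L ^ 2 := by nlinarith
      rw [pow_add, pow_mul L 2 k, h32]
      exact Nat.mul_le_mul_left _ (Nat.mul_le_mul_left _ (Nat.pow_le_pow_left h2 k)))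
    hn (by
      have h1 := Nat.choose_le_pow_of_mul_le (by omega) hn
      have h2 : (k : ℝ) ^ (b + 1) ≤ (L : ℝ) ^ 3 := by
        have : k ^ (b + 1) ≤ L ^ 3 := by
          calc k ^ (b + 1) = k ^ b * k := pow_succ _ _
            _ ≤ L * L ^ 2 := Nat.mul_le_mul (by omega) hk
            _ = L ^ 3 := by ring
        exact_mod_cast this
      have h3 : (L : ℝ) ^ m * ((k : ℝ) ^ (b + 1) * (2 / (L ^ 4 : ℕ)) ^ m) < 1 / 2 := by
        have h4 : (L : ℝ) ^ m * (2 / (L ^ 4 : ℕ)) ^ m ≤ (1 / (2 * L ^ 2)) ^ 2 := by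
          rw [← mul_pow]
          have h5 : (L : ℝ) * (2 / (L ^ 4 : ℕ)) ≤ 1 / (2 * L ^ 2) := by
            push_cast
            rw [mul_div_assoc', div_le_div_iff₀ (by positivity) (by positivity)]
            nlinarith [pow_pos hL0 3]
          refine (pow_le_pow_left₀ (by positivity) h5 m).trans
            (pow_le_pow_of_le_one (by positivity) ?_ hm)
          rw [div_le_one (by positivity)]
          nlinarith
        calc _ = (k : ℝ) ^ (b + 1) * ((L : ℝ) ^ m * (2 / (L ^ 4 : ℕ)) ^ m) := by ring
          _ ≤ (L : ℝ) ^ 3 * (1 / (2 * L ^ 2)) ^ 2 := by gcongr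
          _ = 1 / (4 * L) := by field_simp; norm_num
          _ < 1 / 2 := by
            rw [div_lt_div_iff₀ (by positivity) (by positivity)]
            linarith
      have h6 : (L : ℝ) ^ m * Real.exp (-((k : ℝ) ^ (b + 1) * m) / (32 * L)) ≤ 1 / 4 := by
        have h7 : Real.exp (-((k : ℝ) ^ (b + 1) * m) / (32 * L)) ≤
            Real.exp (-(2 * m * Real.log L)) := by
          refine Real.exp_le_exp.2 ?_
          rw [div_le_iff₀ (by positivity)]
          have := mul_le_mul_of_nonneg_right hlog (Nat.cast_nonneg (α := ℝ) m)
          linarith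
        have h8 : Real.exp (-(2 * m * Real.log L)) = ((L : ℝ) ^ m)⁻¹ * ((L : ℝ) ^ m)⁻¹ := by
          rw [Real.exp_neg, ← mul_inv, ← pow_add, ← two_mul]
          congr 1
          have : 2 * (m : ℝ) * Real.log L = ((2 * m : ℕ) : ℝ) * Real.log L := by push_cast; ring
          rw [this, Real.exp_nat_mul, Real.exp_log hL0]
        calc _ ≤ (L : ℝ) ^ m * (((L : ℝ) ^ m)⁻¹ * ((L : ℝ) ^ m)⁻¹) := by
              rw [← h8]; gcongr
          _ = ((L : ℝ) ^ m)⁻¹ := by field_simp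
          _ ≤ 4⁻¹ := by
            refine inv_anti₀ (by norm_num) (hLR.trans ?_)
            exact le_self_pow₀ (by linarith) (by omega)
          _ = 1 / 4 := by norm_num
      calc _ ≤ (L : ℝ) ^ m * ((k : ℝ) ^ (b + 1) * (2 / (L ^ 4 : ℕ)) ^ m +
            Real.exp (-((k : ℝ) ^ (b + 1) * m) / (32 * L))) := by gcongr
        _ < 1 := by rw [mul_add]; linarith)
  exact exists_points_of_words hbd Y z h

theorem Real.tendsto_rpow_div_log_rpow {a : ℝ} (ha : 0 < a) (c : ℝ) :
    Tendsto (fun x : ℝ => x ^ a / Real.log x ^ c) atTop atTop := by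
  have h := (isLittleO_log_rpow_rpow_atTop c ha).tendsto_div_nhds_zero
  have h2 : Tendsto (fun x : ℝ => Real.log x ^ c / x ^ a) atTop (𝓝[>] 0) := by
    refine tendsto_nhdsWithin_iff.2 ⟨h, ?_⟩
    filter_upwards [eventually_gt_atTop 1] with x hx
    exact div_pos (Real.rpow_pos_of_pos (Real.log_pos hx) _) (Real.rpow_pos_of_pos (by linarith) _)
  refine h2.inv_tendsto_nhdsGT_zero.congr fun x => ?_
  simp

/-- Here `x` plays the role of `log n`. The choice of `b` gives `b ≤ (d - 2) / 2`, so `k ^ b` is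
below `L` by a power of `x`, and `b + 1 ≥ (d - 1) / 2`, so `k ^ (b + 1)` still exceeds `L * log L`.
-/
theorem eventually_parameters {d : ℕ} (hd : 3 ≤ d) {b : ℕ} (hb : b = d / 2 - 1) {ε : ℝ}
    (hε : 0 < ε) (hε1 : ε ≤ 1) :
    ∀ᶠ x : ℝ in atTop, ∀ A : ℝ, A = x ^ (((d : ℝ) - 1) / 2) / Real.log x ^ (((d : ℝ) + 3) / 2) →
      ∀ L k : ℕ, L = ⌊A⌋₊ → k = ⌊ε * x / Real.log x⌋₊ →
      1 < x ∧ 1 ≤ Real.log x ∧ 4 ≤ L ∧ b ≤ L ∧ 4 * k ^ b ≤ L ∧ k ≤ L ^ 2 ∧ A / 2 ≤ L ∧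
      Real.log L ≤ d * Real.log x ∧ (L : ℝ) ≤ Real.exp (x / 2) ∧
      64 * (L : ℝ) * Real.log L ≤ (k : ℝ) ^ (b + 1) := by
  have hdR : (3 : ℝ) ≤ d := by exact_mod_cast hd
  have hbd : (2 * b + 2 : ℝ) ≤ d := by
    have : 2 * b + 2 ≤ d := by omega
    exact_mod_cast this
  have hbd' : (d : ℝ) ≤ 2 * b + 3 := by
    have : d ≤ 2 * b + 3 := by omega
    exact_mod_cast this
  have hlog := Real.tendsto_log_atTop
  have hB := Real.tendsto_rpow_div_log_rpow (a := 1 / 2) (by norm_num) (((d : ℝ) + 3) / 2)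
  have hxl := Real.tendsto_rpow_div_log_rpow (a := 1) (by norm_num) 1
  have hexp : ∀ᶠ x : ℝ in atTop, x ^ (d : ℝ) ≤ Real.exp (x / 2) := by
    have := (isLittleO_rpow_exp_pos_mul_atTop (d : ℝ) (b := 1 / 2) (by norm_num)).bound
      (c := 1) one_pos
    filter_upwards [this, eventually_gt_atTop 0] with x hx hx0
    rw [one_mul, Real.norm_of_nonneg (Real.rpow_nonneg hx0.le _),
      Real.norm_of_nonneg (Real.exp_pos _).le] at hx
    refine hx.trans (le_of_eq ?_)
    congr 1; ring
  filter_upwards [eventually_gt_atTop 1, hlog.eventually_ge_atTop 1, hB.eventually_ge_atTop 8,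
    hB.eventually_ge_atTop (2 * b), hxl.eventually_ge_atTop (2 / ε),
    hlog.eventually_ge_atTop (64 * d / (ε / 2) ^ (b + 1)), hexp]
    with x hx hlx hB8 hBb hxlε hlε hexpx A hA L k hL hk
  set y := Real.log x with hy
  have hx0 : 0 < x := by linarith
  have hy0 : 0 < y := by linarith
  simp only [Real.rpow_one] at hxlε
  set B := x ^ (1 / 2 : ℝ) / y ^ (((d : ℝ) + 3) / 2) with hBdef
  have hAB : A = x ^ (((d : ℝ) - 2) / 2) * B := by
    rw [hA, hBdef, mul_div_assoc', ← Real.rpow_add hx0]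
    congr 2; ring
  have hpow1 : 1 ≤ x ^ (((d : ℝ) - 2) / 2) := Real.one_le_rpow hx.le (by linarith)
  have hpowh : x ^ (1 / 2 : ℝ) ≤ x ^ (((d : ℝ) - 2) / 2) :=
    Real.rpow_le_rpow_of_exponent_le hx.le (by linarith)
  have hpowb : x ^ b ≤ x ^ (((d : ℝ) - 2) / 2) := by
    rw [← Real.rpow_natCast]
    exact Real.rpow_le_rpow_of_exponent_le hx.le (by linarith)
  have hB0 : 0 < B := by linarith
  have hAge : ∀ u v : ℝ, 0 ≤ v → u ≤ x ^ (((d : ℝ) - 2) / 2) → v ≤ B → u * v ≤ A := by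
    intro u v hv hu hvB
    rw [hAB]
    exact mul_le_mul hu hvB hv (by linarith)
  have hA8 : 8 ≤ A := by simpa using hAge 1 8 (by norm_num) hpow1 hB8
  have hLA : (L : ℝ) ≤ A := by rw [hL]; exact Nat.floor_le (by linarith)
  have hL2 : A / 2 ≤ L := by
    have := Nat.lt_floor_add_one A
    rw [← hL] at this
    linarith
  have hxy : x / y ≤ x := div_le_self hx0.le hlx
  have hkle : (k : ℝ) ≤ ε * x / y := by rw [hk]; exact Nat.floor_le (by positivity)
  have hkx : (k : ℝ) ≤ x := by
    refine hkle.trans ?_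
    rw [mul_div_assoc]
    nlinarith
  have hLx : (L : ℝ) ≤ x ^ (d : ℝ) := by
    refine hLA.trans ?_
    rw [hA]
    refine (div_le_self (Real.rpow_nonneg hx0.le _) (Real.one_le_rpow hlx (by linarith))).trans ?_
    exact Real.rpow_le_rpow_of_exponent_le hx.le (by linarith)
  have hL4 : (4 : ℝ) ≤ L := by linarith
  have hlogL : Real.log L ≤ d * y := by
    rw [hy, ← Real.log_rpow hx0]
    exact Real.log_le_log (by linarith) hLx
  refine ⟨hx, hlx, by exact_mod_cast hL4, ?_, ?_, ?_, hL2, hlogL, hLx.trans hexpx, ?_⟩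
  · have h1 : 1 * (2 * b : ℝ) ≤ A := hAge _ _ (by positivity) hpow1 hBb
    have : (b : ℝ) ≤ L := by linarith
    exact_mod_cast this
  · have h1 : x ^ b * 8 ≤ A := hAge _ _ (by norm_num) hpowb hB8
    have h2 : (k : ℝ) ^ b ≤ x ^ b := pow_le_pow_left₀ (Nat.cast_nonneg _) hkx b
    have : 4 * (k : ℝ) ^ b ≤ L := by linarith
    exact_mod_cast this
  · have h1 : x ^ (1 / 2 : ℝ) * 8 ≤ A := hAge _ _ (by norm_num) hpowh hB8
    have h2 : x ^ (1 / 2 : ℝ) ≤ L := by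
      have : 0 ≤ x ^ (1 / 2 : ℝ) := Real.rpow_nonneg hx0.le _
      linarith
    have h3 : x ≤ (L : ℝ) ^ 2 := by
      calc x = (x ^ (1 / 2 : ℝ)) ^ 2 := by
            rw [← Real.rpow_natCast, ← Real.rpow_mul hx0.le]; norm_num
        _ ≤ _ := pow_le_pow_left₀ (Real.rpow_nonneg hx0.le _) h2 2
    exact_mod_cast hkx.trans h3
  · have hxyε : 2 ≤ ε * (x / y) := by
      rwa [div_le_iff₀' hε] at hxlε
    have hkge : ε / 2 * (x / y) ≤ k := by
      have := Nat.lt_floor_add_one (ε * x / y)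
      rw [← hk, mul_div_assoc] at this
      linarith
    have hxy1 : 1 ≤ x / y := by nlinarith
    have hxy0 : 0 < x / y := by linarith
    have h1 : (ε / 2) ^ (b + 1) * (x / y) ^ (b + 1) ≤ (k : ℝ) ^ (b + 1) := by
      rw [← mul_pow]
      exact pow_le_pow_left₀ (by positivity) hkge _
    have h2 : (x / y) ^ (((d : ℝ) - 1) / 2) ≤ (x / y) ^ (b + 1) := by
      rw [← Real.rpow_natCast]
      refine Real.rpow_le_rpow_of_exponent_le hxy1 ?_
      push_cast
      linarith
    -- The exponent `(d + 3) / 2` is `(d - 1) / 2 + 2`: one factor `y` pays for `log L`, the other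
    -- absorbs the constants.
    have h3 : A * y * y = (x / y) ^ (((d : ℝ) - 1) / 2) := by
      rw [hA, Real.div_rpow hx0.le hy0.le]
      have : y ^ (((d : ℝ) + 3) / 2) = y ^ (((d : ℝ) - 1) / 2) * (y * y) := by
        rw [← sq, ← Real.rpow_natCast, ← Real.rpow_add hy0]
        congr 1; push_cast; ring
      rw [this]
      have h4 : y ^ (((d : ℝ) - 1) / 2) ≠ 0 := (Real.rpow_pos_of_pos hy0 _).ne'
      field_simp
    have h5 : 64 * d ≤ (ε / 2) ^ (b + 1) * y := by
      rwa [div_le_iff₀' (by positivity)] at hlε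
    have hlogL0 : 0 ≤ Real.log L := Real.log_nonneg (by linarith)
    calc 64 * (L : ℝ) * Real.log L ≤ 64 * A * (d * y) := by gcongr
      _ = 64 * d * (A * y) := by ring
      _ ≤ (ε / 2) ^ (b + 1) * y * (A * y) := by gcongr
      _ = (ε / 2) ^ (b + 1) * (A * y * y) := by ring
      _ ≤ (ε / 2) ^ (b + 1) * (x / y) ^ (b + 1) := by rw [h3]; gcongr
      _ ≤ _ := h1

end Parameters

theorem theorem4 (d : ℕ) (hd : 3 ≤ d) :
    ∃ c : ℝ, 0 < c ∧ ∀ᶠ n : ℕ in Filter.atTop,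
      ∃ P : Finset (Fin d → ℝ), P.card = n ∧
        ((delaunayGraph (axisParallelBoxes d) (P : Set (Fin d → ℝ))).indepNum : ℝ) ≤
          c * (n : ℝ) * Real.log (Real.log (n : ℝ)) ^ (((d : ℝ) + 3) / 2) /
            Real.log (n : ℝ) ^ (((d : ℝ) - 1) / 2) := by
  refine ⟨16, by norm_num, ?_⟩
  obtain ⟨b, hb⟩ : ∃ b, b = d / 2 - 1 := ⟨_, rfl⟩
  have hdR : (3 : ℝ) ≤ d := by exact_mod_cast hd
  -- Chosen so that `L ^ (32 * (k * b) + 2 * k) ≤ exp (x / 2)`, the square root of `n`, using `log L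
  -- ≤ d * log x`.
  set N : ℝ := 2 * (d * (32 * b + 2)) with hN
  have hN1 : 1 ≤ N := by
    have hb0 : (0 : ℝ) ≤ b := Nat.cast_nonneg b
    nlinarith
  have hev := eventually_parameters hd hb (ε := 1 / N) (by positivity)
    ((div_le_one (by linarith)).2 hN1)
  filter_upwards [(Real.tendsto_log_atTop.comp tendsto_natCast_atTop_atTop).eventually hev,
    Filter.eventually_gt_atTop 0] with n hn hn0
  obtain ⟨hx, hlx, hL4, hbL, hkb, hk, hAL, hlogL, hLexp, hlog⟩ := hn _ rfl _ _ rfl rfl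
  simp only [Function.comp_apply] at hx hlx hL4 hbL hkb hk hAL hlogL hLexp hlog
  set x := Real.log (n : ℝ) with hxdef
  set A := x ^ (((d : ℝ) - 1) / 2) / Real.log x ^ (((d : ℝ) + 3) / 2) with hA
  set L := ⌊A⌋₊ with hL
  set k := ⌊1 / N * x / Real.log x⌋₊ with hkdef
  have hnR : (0 : ℝ) < n := by exact_mod_cast hn0
  have hnexp : (n : ℝ) = Real.exp x := (Real.exp_log hnR).symm
  have hLR : (4 : ℝ) ≤ L := by exact_mod_cast hL4
  have hL0 : (0 : ℝ) < L := by linarith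
  have hx0 : 0 < x := by linarith
  have hlx0 : 0 < Real.log x := by linarith
  set m := ⌈(8 * n : ℝ) / L⌉₊ with hm
  have hmge : (8 * n : ℝ) / L ≤ m := Nat.le_ceil _
  have hpow : (L : ℝ) ^ (32 * (k * b) + 2 * k) ≤ Real.exp (x / 2) := by
    rw [← Real.exp_log hL0, ← Real.exp_nat_mul]
    refine Real.exp_le_exp.2 ?_
    have hkle : (k : ℝ) ≤ 1 / N * x / Real.log x := Nat.floor_le (by positivity)
    rw [le_div_iff₀ hlx0] at hkle
    have hlogL0 : 0 ≤ Real.log L := Real.log_nonneg (by linarith)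
    calc ((32 * (k * b) + 2 * k : ℕ) : ℝ) * Real.log L
        = (32 * b + 2) * k * Real.log L := by push_cast; ring
      _ ≤ (32 * b + 2) * k * (d * Real.log x) := by gcongr
      _ = (d * (32 * b + 2)) * (k * Real.log x) := by ring
      _ ≤ (d * (32 * b + 2)) * (1 / N * x) := by gcongr
      _ = x / 2 := by
        rw [hN]
        have : (0 : ℝ) < d := by linarith
        field_simp
  have hC : 8 * L ^ (32 * (k * b) + 2 * k) ≤ m := by
    have h1 : 8 * Real.exp (x / 2) ≤ (8 * n : ℝ) / L := by
      rw [le_div_iff₀ hL0, hnexp]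
      have h2 : Real.exp x = Real.exp (x / 2) * Real.exp (x / 2) := by
        rw [← Real.exp_add]; congr 1; ring
      rw [h2]
      nlinarith [Real.exp_pos (x / 2)]
    have : 8 * (L : ℝ) ^ (32 * (k * b) + 2 * k) ≤ m := by linarith
    exact_mod_cast this
  have hm2 : 2 ≤ m := by
    have : 1 ≤ L ^ (32 * (k * b) + 2 * k) := Nat.one_le_pow _ _ (by omega)
    omega
  have hnL : 8 * n ≤ L * m := by
    rw [div_le_iff₀' hL0] at hmge
    exact_mod_cast hmge
  obtain ⟨P, hP, hind⟩ := exists_points_indepNum_lt (d := d) (by omega) hL4 hbL hkb hk hm2 hC hnL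
    hlog
  refine ⟨P, hP, ?_⟩
  have h1 : ((delaunayGraph (axisParallelBoxes d) (P : Set (Fin d → ℝ))).indepNum : ℝ) ≤
      (8 * n : ℝ) / L := (Nat.lt_ceil.1 hind).le
  refine h1.trans ?_
  have hA0 : 0 < A := div_pos (Real.rpow_pos_of_pos hx0 _) (Real.rpow_pos_of_pos hlx0 _)
  -- Rounding down `A` costs at most a factor `2`, whence the constant `16`.
  calc (8 * n : ℝ) / L ≤ 8 * n / (A / 2) := by gcongr
    _ = _ := by
      have h2 := (Real.rpow_pos_of_pos hx0 (((d : ℝ) - 1) / 2)).ne'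
      have h3 := (Real.rpow_pos_of_pos hlx0 (((d : ℝ) + 3) / 2)).ne'
      rw [hA]
      field_simp
      norm_num
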